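/- Let $\Omega\subset\mathbb R^3$ be a non-empty, bounded, connected open set with $C^2$ boundary. Let $\mu>0$, $3\lambda+2\mu>0$, $m=\min\{\mu,3\lambda+2\mu\}$, $\Delta^*=\mu\Delta+(\lambda+\mu)\nabla(\nabla\cdot)$, and let $T u=2\mu\,\mathbf n\cdot\nabla u+\lambda\,\mathbf n\,\nabla\cdot u+\mu\,\mathbf n\times\nabla\times u$ be the traction on $\partial\Omega$, where $\mathbf n$ is the outward unit normal. Let $\rho\in L^\infty(\Omega)$ be real and positive, let $\rho_*$ and $\rho^*$ be its (essential) infimum and supremum over $\Omega$, and assume that $\rho_*>1$ or $\rho^*<1$. Let $\lambda_1(\Omega)$ be the first Dirichlet eigenvalue of $-\Delta$ in $\Omega$, and let $\omega\in\mathbb R$, $\omega\neq0$, satisfy $$\omega^2<\min\Big\{\frac{m\,\lambda_1(\Omega)}{\rho^*},\; m\,\lambda_1(\Omega)\Big\}.$$ Let $\mathcal H(\Omega)=\{u\in (H^1(\Omega))^3 : \Delta^*u\in (L^2(\Omega))^3\}$ with norm $\|u\|_{\mathcal H(\Omega)}^2=\|u\|_{H^1(\Omega)}^2+\|\Delta^*u\|_{L^2(\Omega)}^2$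 (complex-valued fields), and for $u\in\mathcal H(\Omega)$ let $\gamma_0u=u|_{\partial\Omega}\in (H^{1/2}(\partial\Omega))^3$ and $\gamma_1u=Tu|_{\partial\Omega}\in (H^{-1/2}(\partial\Omega))^3$ be its traces, $\gamma_1$ being defined by Green's formula. Then there is a constant $C>0$, depending only on $\Omega,\lambda,\mu,\rho,\omega$, such that for all $f\in (H^{1/2}(\partial\Omega))^3$, $h\in (H^{-1/2}(\partial\Omega))^3$ and $u_0\in\mathcal H(\Omega)$ with $\gamma_0u_0=f$ and $\gamma_1u_0=h$, the interior transmission problem $$\Delta^*U+\omega^2\rho\,U=0,\qquad \Delta^*V+\omega^2V=0\quad\text{in }\Omega,$$ $$U-V=f,\qquad TU-TV=h\quad\text{on }\partial\Omega$$ (the equations hold in the sense of distributions; the boundary conditions mean that $U-V\in\mathcal H(\Omega)$, $\gamma_0(U-V)=f$ and $\gamma_1(U-V)=h$) has a unique solution $(U,V)\in (L^2(\Omega))^3\times (L^2(\Omega))^3$, and this solution satisfies $$\|U\|_{L^2(\Omega)}+\|V\|_{L^2(\Omega)}\le C\,\|u_0\|_{\mathcal H(\Omega)}.$$ -/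

import Mathlib

open MeasureTheory TopologicalSpace
open scoped Distributions LineDeriv ENNReal ComplexConjugate

noncomputable section

namespace Elastic

/-- Euclidean space `ℝ³`. -/
abbrev E3 : Type := EuclideanSpace ℝ (Fin 3)

/-- The `j`-th standard basis vector of `ℝ³`. -/
def e (j : Fin 3) : E3 := EuclideanSpace.single j 1

/-- `Ω` has a `C²` boundary: near each boundary point, `Ω` is the set where a `C²` function
with non-vanishing derivative is negative. -/
def HasC2Boundary (Ω : Opens E3) : Prop :=
  ∀ x ∈ frontier (Ω : Set E3), ∃ W : Set E3, IsOpen W ∧ x ∈ W ∧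
    ∃ ψ : E3 → ℝ, ContDiffOn ℝ 2 ψ W ∧ (∀ y ∈ W, fderiv ℝ ψ y ≠ 0) ∧
      ψ x = 0 ∧ ∀ y ∈ W, (y ∈ Ω ↔ ψ y < 0)

/-- The complex space `L²(Ω)`. -/
abbrev L2 (Ω : Opens E3) : Type := Lp ℂ 2 (volume.restrict (Ω : Set E3))

/-- The space `(L²(Ω))³`, with `‖u‖² = ∑ i, ‖u i‖²`. -/
abbrev L2v (Ω : Opens E3) : Type := PiLp 2 (fun _ : Fin 3 => L2 Ω)

variable {Ω : Opens E3}

/-- `v = ∂_j u` in the sense of distributions on `Ω`. -/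
def IsWeakPartial (j : Fin 3) (u v : L2 Ω) : Prop :=
  ∀ φ : 𝓓(Ω, ℂ), ∫ x in (Ω : Set E3), u x * (∂_{e j} φ) x = -∫ x in (Ω : Set E3), v x * φ x

lemma integrable_mul_test (u : L2 Ω) (φ : 𝓓(Ω, ℂ)) :
    Integrable (fun x => u x * φ x) (volume.restrict (Ω : Set E3)) := by
  have h2 : MemLp (φ : E3 → ℂ) 2 (volume.restrict (Ω : Set E3)) :=
    (φ.continuous.memLp_of_hasCompactSupport φ.hasCompactSupport).restrict _
  exact (Lp.memLp u).integrable_mul h2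

lemma integral_add_mul_test (u v : L2 Ω) (φ : 𝓓(Ω, ℂ)) :
    ∫ x in (Ω : Set E3), (u + v) x * φ x =
      (∫ x in (Ω : Set E3), u x * φ x) + ∫ x in (Ω : Set E3), v x * φ x := by
  rw [← integral_add (integrable_mul_test u φ) (integrable_mul_test v φ)]
  refine integral_congr_ae ?_
  filter_upwards [Lp.coeFn_add u v] with x hx
  simp only [hx, Pi.add_apply, add_mul]

lemma integral_smul_mul_test (c : ℂ) (u : L2 Ω) (φ : 𝓓(Ω, ℂ)) :
    ∫ x in (Ω : Set E3), (c • u) x * φ x = c * ∫ x in (Ω : Set E3), u x * φ x := by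
  rw [← integral_const_mul]
  refine integral_congr_ae ?_
  filter_upwards [Lp.coeFn_smul c u] with x hx
  simp only [hx, Pi.smul_apply, smul_eq_mul, mul_assoc]

lemma integral_zero_mul_test (φ : 𝓓(Ω, ℂ)) :
    ∫ x in (Ω : Set E3), (0 : L2 Ω) x * φ x = 0 := by
  simpa using integral_smul_mul_test 0 (0 : L2 Ω) φ

/-- The Sobolev space `H¹(Ω)`, realised as the space of pairs `(u, ∇u)` of an `L²` function and its
weak gradient in `(L²)³` (the gradient is determined by `u`). The norm inherited from the product is
`‖u‖² = ‖u‖²_{L²} + ∑ j, ‖∂_j u‖²_{L²}`. -/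
def H1 (Ω : Opens E3) : Submodule ℂ (WithLp 2 (L2 Ω × L2v Ω)) where
  carrier := {p | ∀ j, IsWeakPartial j p.fst (p.snd j)}
  zero_mem' := by
    intro j φ
    simp only [WithLp.zero_fst, WithLp.zero_snd, PiLp.zero_apply]
    rw [integral_zero_mul_test, integral_zero_mul_test, neg_zero]
  add_mem' := by
    intro p q hp hq j φ
    simp only [WithLp.add_fst, WithLp.add_snd, PiLp.add_apply]
    rw [integral_add_mul_test, integral_add_mul_test, hp j φ, hq j φ, neg_add]
  smul_mem' := by
    intro c p hp j φ
    simp only [WithLp.smul_fst, WithLp.smul_snd, PiLp.smul_apply]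
    rw [integral_smul_mul_test, integral_smul_mul_test, hp j φ, mul_neg]

/-- The underlying `L²` function of an element of `H¹(Ω)`. -/
def H1.fn : H1 Ω →L[ℂ] L2 Ω :=
  (WithLp.fstL 2 ℂ (L2 Ω) (L2v Ω)).comp (H1 Ω).subtypeL

/-- The weak partial derivative `∂_j u ∈ L²(Ω)` of `u ∈ H¹(Ω)`. -/
def H1.pd (j : Fin 3) : H1 Ω →L[ℂ] L2 Ω :=
  (PiLp.proj 2 (𝕜 := ℂ) (fun _ : Fin 3 => L2 Ω) j).comp
    ((WithLp.sndL 2 ℂ (L2 Ω) (L2v Ω)).comp (H1 Ω).subtypeL)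

/-- The element `u` of `H¹(Ω)` is the test function `φ`. -/
def H1.IsTest (u : H1 Ω) (φ : 𝓓(Ω, ℂ)) : Prop :=
  H1.fn u =ᵐ[volume.restrict (Ω : Set E3)] φ ∧
    ∀ j, H1.pd j u =ᵐ[volume.restrict (Ω : Set E3)] (∂_{e j} φ : 𝓓(Ω, ℂ))

/-- `H¹₀(Ω)`, the closure of the test functions in `H¹(Ω)`. -/
def H10 (Ω : Opens E3) : Submodule ℂ (H1 Ω) :=
  (Submodule.span ℂ {u : H1 Ω | ∃ φ : 𝓓(Ω, ℂ), H1.IsTest u φ}).topologicalClosure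

/-- The first Dirichlet eigenvalue of `-Δ` in `Ω`: the minimum of the Rayleigh quotient
`‖∇u‖² / ‖u‖²` over the nonzero `u ∈ H¹₀(Ω)`. -/
def dirichletEigenvalue (Ω : Opens E3) : ℝ :=
  sInf {r : ℝ | ∃ u ∈ H10 Ω, H1.fn u ≠ 0 ∧
    r = (∑ j, ‖H1.pd j u‖ ^ 2) / ‖H1.fn u‖ ^ 2}

/-- The space `(H¹(Ω))³`. -/
abbrev H1v (Ω : Opens E3) : Type := PiLp 2 (fun _ : Fin 3 => H1 Ω)

/-- The underlying `L²` field of an element of `(H¹(Ω))³`. -/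
def H1v.fn (u : H1v Ω) : L2v Ω := WithLp.toLp 2 fun i => H1.fn (u i)

/-- The Lamé operator `Δ* φ = μ Δ φ + (λ + μ) ∇ (∇ · φ)` on (complex) vector test functions,
`i`-th component. -/
def lameTest (lam mu : ℝ) (φ : Fin 3 → 𝓓(Ω, ℂ)) (i : Fin 3) : 𝓓(Ω, ℂ) :=
  mu • (∑ j, ∂_{e j} (∂_{e j} (φ i))) + (lam + mu) • ∑ j, ∂_{e i} (∂_{e j} (φ j))

/-- `Δ* u = g` in `Ω` in the sense of distributions. -/
def IsWeakLame (lam mu : ℝ) (u : L2v Ω) (g : Fin 3 → E3 → ℂ) : Prop :=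
  ∀ φ : Fin 3 → 𝓓(Ω, ℂ),
    ∑ i, ∫ x in (Ω : Set E3), u i x * lameTest lam mu φ i x =
      ∑ i, ∫ x in (Ω : Set E3), g i x * φ i x

/-- The space `ℋ(Ω) = {u ∈ (H¹(Ω))³ | Δ* u ∈ (L²(Ω))³}`, realised as the space of pairs
`(u, Δ* u)`, with norm `‖u‖² = ‖u‖²_{H¹} + ‖Δ* u‖²_{L²}`. -/
def HLame (Ω : Opens E3) (lam mu : ℝ) : Submodule ℂ (WithLp 2 (H1v Ω × L2v Ω)) where
  carrier := {p | IsWeakLame lam mu (H1v.fn p.fst) (fun i => p.snd i)}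
  zero_mem' := by
    intro φ
    simp only [H1v.fn, WithLp.zero_fst, WithLp.zero_snd, PiLp.zero_apply, map_zero]
    simp only [integral_zero_mul_test]
  add_mem' := by
    intro p q hp hq φ
    have h1 := hp φ
    have h2 := hq φ
    simp only [H1v.fn, WithLp.add_fst, WithLp.add_snd, PiLp.add_apply, map_add] at h1 h2 ⊢
    simp only [integral_add_mul_test, Finset.sum_add_distrib, h1, h2]
  smul_mem' := by
    intro c p hp φ
    have h1 := hp φ
    simp only [H1v.fn, WithLp.smul_fst, WithLp.smul_snd, PiLp.smul_apply, map_smul] at h1 ⊢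
    simp only [integral_smul_mul_test, ← Finset.mul_sum, h1]

variable {lam mu : ℝ}

/-- The `(H¹(Ω))³` field underlying an element of `ℋ(Ω)`. -/
def HLame.toH1v (u : HLame Ω lam mu) : H1v Ω := (u : WithLp 2 (H1v Ω × L2v Ω)).fst

/-- `Δ* u ∈ (L²(Ω))³` for `u ∈ ℋ(Ω)`. -/
def HLame.lame (u : HLame Ω lam mu) : L2v Ω := (u : WithLp 2 (H1v Ω × L2v Ω)).snd

/-- The stress tensor `σ(u) = λ (∇ · u) I + μ (∇u + (∇u)ᵀ)` of `u ∈ (H¹(Ω))³`. -/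
def stress (lam mu : ℝ) (u : H1v Ω) (i j : Fin 3) : L2 Ω :=
  (if i = j then (lam : ℂ) • ∑ k, H1.pd k (u k) else 0) +
    (mu : ℂ) • (H1.pd j (u i) + H1.pd i (u j))

/-- The trace space `H^{1/2}(∂Ω)`: the space of boundary values of `H¹(Ω)`, where two functions have
the same boundary values iff their difference lies in `H¹₀(Ω)`; with the quotient norm. -/
abbrev HHalf (Ω : Opens E3) : Type := H1 Ω ⧸ H10 Ω

/-- The space `H^{-1/2}(∂Ω)`: the (anti-)dual of `H^{1/2}(∂Ω)`. -/
abbrev HMinusHalf (Ω : Opens E3) : Type := HHalf Ω →L⋆[ℂ] ℂ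

/-- The trace `γ₀ u = u|_{∂Ω} ∈ (H^{1/2}(∂Ω))³`. -/
def trace0 (u : H1v Ω) : Fin 3 → HHalf Ω := fun i => (H10 Ω).mkQ (u i)

/-- The functional `φ ↦ ∫_Ω ∑_j σ(u)_{ij} conj(∂_j φ) + (Δ* u)_i conj φ` on `H¹(Ω)`; by Green's
formula it is the `i`-th component of `φ ↦ ∫_{∂Ω} (T u) conj φ ds`. -/
def greenForm (u : HLame Ω lam mu) (i : Fin 3) : H1 Ω →L⋆[ℂ] ℂ :=
  (∑ j, (innerSLFlip ℂ (stress lam mu (HLame.toH1v u) i j)).comp (H1.pd j)) +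
    (innerSLFlip ℂ (HLame.lame u i)).comp H1.fn

/-- The complex conjugate of a test function. -/
def conjTest (φ : 𝓓(Ω, ℂ)) : 𝓓(Ω, ℂ) where
  toFun x := conj (φ x)
  contDiff' := Complex.conjCLE.contDiff.comp φ.contDiff
  hasCompactSupport' := φ.hasCompactSupport.comp_left (g := conj) (map_zero _)
  tsupport_subset' := (tsupport_comp_subset (g := conj) (map_zero _) φ).trans φ.tsupport_subset

lemma lineDeriv_test_apply (φ : 𝓓(Ω, ℂ)) (v : E3) (x : E3) :
    (∂_{v} φ : 𝓓(Ω, ℂ)) x = fderiv ℝ φ x v := by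
  rw [TestFunction.lineDerivOp_eq_lineDerivCLM ℝ, TestFunction.lineDerivCLM_eq_fderivCLM,
    TestFunction.fderivCLM_apply_of_le _ (by simp)]

lemma conjTest_apply (φ : 𝓓(Ω, ℂ)) (x : E3) : conjTest φ x = conj (φ x) := rfl

lemma lineDeriv_conjTest (φ : 𝓓(Ω, ℂ)) (v : E3) :
    (∂_{v} (conjTest φ) : 𝓓(Ω, ℂ)) = conjTest (∂_{v} φ) := by
  ext x
  rw [conjTest_apply, lineDeriv_test_apply, lineDeriv_test_apply]
  have hd : DifferentiableAt ℝ φ x := (φ.contDiff.differentiable (by simp)) x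
  have h := (Complex.conjCLE.hasFDerivAt (x := φ x)).comp x hd.hasFDerivAt
  have h' : HasFDerivAt (conjTest φ) _ x := h
  rw [h'.fderiv]
  simp

lemma lineDeriv_comm_test (φ : 𝓓(Ω, ℂ)) (v w : E3) :
    (∂_{v} (∂_{w} φ : 𝓓(Ω, ℂ)) : 𝓓(Ω, ℂ)) = ∂_{w} (∂_{v} φ : 𝓓(Ω, ℂ)) := by
  ext x
  have hφ : ContDiff ℝ 2 φ := φ.contDiff.of_le (WithTop.coe_le_coe.2 le_top)
  have hd : DifferentiableAt ℝ (fderiv ℝ φ) x :=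
    (hφ.fderiv_right (m := 1) (by norm_num)).differentiable (by simp) x
  have aux : ∀ a b : E3, (∂_{a} (∂_{b} φ : 𝓓(Ω, ℂ)) : 𝓓(Ω, ℂ)) x =
      fderiv ℝ (fderiv ℝ φ) x a b := by
    intro a b
    have hb : ((∂_{b} φ : 𝓓(Ω, ℂ)) : E3 → ℂ) = fun y => fderiv ℝ φ y b := by
      ext y; exact lineDeriv_test_apply φ b y
    rw [lineDeriv_test_apply, hb, fderiv_clm_apply hd (differentiableAt_const b)]
    simp
  rw [aux, aux]
  exact (hφ.contDiffAt.isSymmSndFDerivAt (by simp)) v w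

lemma integral_mul_test_add (u : L2 Ω) (φ χ : 𝓓(Ω, ℂ)) :
    ∫ x in (Ω : Set E3), u x * (φ + χ) x =
      (∫ x in (Ω : Set E3), u x * φ x) + ∫ x in (Ω : Set E3), u x * χ x := by
  rw [← integral_add (integrable_mul_test u φ) (integrable_mul_test u χ)]
  simp [mul_add]

lemma integral_mul_test_smul (c : ℝ) (u : L2 Ω) (φ : 𝓓(Ω, ℂ)) :
    ∫ x in (Ω : Set E3), u x * (c • φ) x = c * ∫ x in (Ω : Set E3), u x * φ x := by
  rw [← integral_const_mul]
  refine integral_congr_ae (.of_forall fun x => ?_)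
  simp; ring

/-- The bilinear pairing `∫_Ω u φ`. -/
def pairing : L2 Ω →ₗ[ℂ] 𝓓(Ω, ℂ) →ₗ[ℝ] ℂ :=
  LinearMap.mk₂' ℂ ℝ (fun u φ => ∫ x in (Ω : Set E3), u x * φ x) integral_add_mul_test
    integral_smul_mul_test integral_mul_test_add
    (fun c u φ => by simpa using integral_mul_test_smul c u φ)

lemma inner_test (u : H1 Ω) (φ : 𝓓(Ω, ℂ)) (h : H1.IsTest u φ) (w : L2 Ω) :
    inner ℂ (H1.fn u) w = pairing w (conjTest φ) := by
  rw [L2.inner_def]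
  refine integral_congr_ae ?_
  filter_upwards [h.1] with x hx
  simp [hx, conjTest_apply]

lemma inner_pd_test (u : H1 Ω) (φ : 𝓓(Ω, ℂ)) (h : H1.IsTest u φ) (w : L2 Ω) (j : Fin 3) :
    inner ℂ (H1.pd j u) w = pairing w (∂_{e j} (conjTest φ)) := by
  rw [L2.inner_def, lineDeriv_conjTest]
  refine integral_congr_ae ?_
  filter_upwards [h.2 j] with x hx
  simp [hx, conjTest_apply]

lemma pairing_lineDeriv (u : H1 Ω) (j : Fin 3) (φ : 𝓓(Ω, ℂ)) :
    pairing (H1.fn u) (∂_{e j} φ) = - pairing (H1.pd j u) φ := u.2 j φ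

lemma greenForm_test (u : HLame Ω lam mu) (i : Fin 3) (w : H1 Ω) (φ : 𝓓(Ω, ℂ))
    (h : H1.IsTest w φ) : greenForm u i w = 0 := by
  have key : ∀ Φ : Fin 3 → 𝓓(Ω, ℂ), 
      ∑ k, pairing (H1.fn (HLame.toH1v u k)) (lameTest lam mu Φ k) = 
        ∑ k, pairing (HLame.lame u k) (Φ k) := u.2
  have h1 := key (Pi.single i (conjTest φ))
  have h2 : ∀ j : Fin 3, pairing (H1.pd i (HLame.toH1v u j)) (∂_{e j} (conjTest φ)) =
      pairing (H1.pd j (HLame.toH1v u j)) (∂_{e i} (conjTest φ)) := by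
    intro j
    rw [← neg_inj, ← pairing_lineDeriv, ← pairing_lineDeriv, lineDeriv_comm_test]
  have h3 : ∑ k, pairing (HLame.lame u k) ((Pi.single i (conjTest φ) : Fin 3 → 𝓓(Ω, ℂ)) k) =
      pairing (HLame.lame u i) (conjTest φ) := by
    rw [Finset.sum_eq_single i (fun k _ hk => by simp [Pi.single_eq_of_ne hk]) (by simp)]
    simp
  have h4 : greenForm u i w =
      (∑ j, pairing (stress lam mu (HLame.toH1v u) i j) (∂_{e j} (conjTest φ))) +
        pairing (HLame.lame u i) (conjTest φ) := by
    simp only [greenForm, add_apply, sum_apply,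
      ContinuousLinearMap.comp_apply, innerSLFlip_apply_apply, inner_test w φ h,
      inner_pd_test w φ h]
  have h5 : ∀ k j : Fin 3, (∂_{e j} ((Pi.single i (conjTest φ) : Fin 3 → 𝓓(Ω, ℂ)) k) : 𝓓(Ω, ℂ)) =
      if k = i then ∂_{e j} (conjTest φ) else 0 := by
    intro k j
    rcases eq_or_ne k i with rfl | hk
    · simp
    · rw [Pi.single_eq_of_ne hk, if_neg hk, TestFunction.lineDerivOp_eq_lineDerivCLM ℝ, map_zero]
  rw [h4, ← h3, ← h1]
  have h6 : ∀ k, pairing (H1.fn (HLame.toH1v u k)) (lameTest lam mu (Pi.single i (conjTest φ)) k) =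
      -(mu * ∑ j, if k = i then pairing (H1.pd j (HLame.toH1v u k)) (∂_{e j} (conjTest φ)) else 0)
      - (lam + mu) * pairing (H1.pd k (HLame.toH1v u k)) (∂_{e i} (conjTest φ)) := by
    intro k
    have hs : ∀ v : L2 Ω, ∑ j, -pairing v (if j = i then ∂_{e j} (conjTest φ) else 0) =
        -pairing v (∂_{e i} (conjTest φ)) := by
      intro v
      rw [Finset.sum_eq_single i (fun j _ hj => by simp [hj]) (by simp), if_pos rfl]
    simp only [lameTest, map_add, map_smul, map_sum, pairing_lineDeriv, h5, hs]
    by_cases hk : k = i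
    · simp only [hk, if_true, Complex.real_smul, Complex.ofReal_add, Finset.sum_neg_distrib]
      ring
    · simp only [hk, if_false, map_zero, neg_zero, Finset.sum_const_zero, smul_zero,
        mul_zero, Complex.real_smul, Complex.ofReal_add]
      ring
  have h7 : ∀ j, pairing (stress lam mu (HLame.toH1v u) i j) (∂_{e j} (conjTest φ)) =
      (if i = j then lam * ∑ k, pairing (H1.pd k (HLame.toH1v u k)) (∂_{e j} (conjTest φ)) else 0) +
      mu * (pairing (H1.pd j (HLame.toH1v u i)) (∂_{e j} (conjTest φ)) +
        pairing (H1.pd j (HLame.toH1v u j)) (∂_{e i} (conjTest φ))) := by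
    intro j
    rw [← h2 j]
    unfold stress
    split_ifs <;> simp [Finset.mul_sum, mul_add]
  simp only [h6, h7, Finset.sum_add_distrib, Finset.sum_sub_distrib, Finset.sum_neg_distrib,
    ← Finset.mul_sum, Finset.sum_ite_eq, Finset.mem_univ, if_true]
  rw [Finset.sum_eq_single i (f := fun k => ∑ j, if k = i then
    pairing (H1.pd j (HLame.toH1v u k)) (∂_{e j} (conjTest φ)) else 0)
    (fun j _ hj => by simp [hj]) (by simp)]
  simp only [if_true]
  ring

lemma H10_le_ker_greenForm (u : HLame Ω lam mu) (i : Fin 3) : H10 Ω ≤ (greenForm u i).ker := by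
  refine Submodule.topologicalClosure_minimal _ (Submodule.span_le.2 ?_) (greenForm u i).isClosed_ker
  rintro w ⟨φ, h⟩
  exact greenForm_test u i w φ h

/-- The conormal trace `γ₁ u = T u|_{∂Ω} ∈ (H^{-1/2}(∂Ω))³` of `u ∈ ℋ(Ω)`, where
`T = 2 μ n · grad + λ n div + μ n × curl` is the traction operator (so `T u = σ(u) n`), defined by
Green's formula `⟨γ₁ u, γ₀ φ⟩ = ∫_Ω σ(u) : conj ∇φ + Δ* u · conj φ`. -/
def trace1 (u : HLame Ω lam mu) : Fin 3 → HMinusHalf Ω := fun i =>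
  (H10 Ω).liftQL (greenForm u i) (H10_le_ker_greenForm u i)

/-- `(U, V) ∈ (L²(Ω))³ × (L²(Ω))³` solves the interior transmission problem
`Δ* U + ω² ρ U = 0` and `Δ* V + ω² V = 0` in `Ω` (in the sense of distributions),
`U - V = f` and `T U - T V = h` on `∂Ω` (`U - V` lies in `ℋ(Ω)` and has the traces `f` and `h`). -/
structure IsITPSolution (Ω : Opens E3) (lam mu ω : ℝ) (ρ : E3 → ℝ)
    (f : Fin 3 → HHalf Ω) (h : Fin 3 → HMinusHalf Ω) (U V : L2v Ω) : Prop where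
  eqU : IsWeakLame lam mu U (fun i x => -(ω ^ 2 * ρ x : ℝ) * U i x)
  eqV : IsWeakLame lam mu V (fun i x => -(ω ^ 2 : ℝ) * V i x)
  boundary : ∃ u : HLame Ω lam mu, H1v.fn (HLame.toH1v u) = U - V ∧
    trace0 (HLame.toH1v u) = f ∧ trace1 u = h

end Elastic

end

/-! Write s = ω². Subtracting the two equations, u = U − V satisfies (Δ* + sρ)u = −s(ρ − 1)V. Since
ρ − 1 is bounded away from 0, V = −s⁻¹(ρ − 1)⁻¹(Δ* + sρ)u, so u determines both unknowns. What
remains is (Δ* + s)V = 0, a fourth-order problem for u. Put u = u₀ + w with w in the closed space X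
⊂ ℋ(Ω) of fields with zero Cauchy data; the problem reads ⟨(Δ* + s)g, (ρ − 1)⁻¹(Δ* + sρ)(u₀ + w)⟩ =
0 for all g in X. If the form is coercive on X, Lax–Milgram gives w as a bounded linear function of
u₀, and existence, uniqueness and the estimate follow together (`exists_variational_solution`,
`exists_solution_operators`).

Two facts make this work. The first is density: distributional equations are tested with compactly
supported fields, the variational one with all of X. A field with zero Cauchy data, extended by
zero, has its gradient and Δ* in L² of the whole space; localising it, pushing each piece into Ω by
the segment property and mollifying shows that test fields are dense in X for the graph norm
(`ExtField.testApprox`, `mem_closure_testGraph`).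

The second is coercivity. Korn's inequality and the Rayleigh quotient give −Re⟨g, Δ*g⟩ ≥ mλ₁‖g‖² on
X (`HLame.poincare_zeroData`). Completing the square then leaves a definite term with weight |ρ −
1|⁻¹ plus s(mλ₁ − sρ^*)‖g‖² when ρ > 1, or s(mλ₁ − s)‖g‖² when ρ < 1, up to an overall sign
(`coercive_of_one_lt`, `coercive_of_lt_one`). The smallness of ω² makes these positive. -/

noncomputable section

namespace Elastic

/-! ### Mollification in L² -/

section
open Filter Topology ContDiff Convolution

/-- Translation is continuous in `L²`. -/
lemma tendsto_eLpNorm_translate_sub {w : E3 → ℂ} (hw : MemLp w 2 volume) :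
    Tendsto (fun y : E3 => eLpNorm (fun x => w (x - y) - w x) 2 volume) (𝓝 0) (𝓝 0) := by
  have : Fact ((2 : ℝ≥0∞) ≠ ⊤) := ⟨by simp⟩
  have h1 : Tendsto (fun y : E3 => DomAddAct.mk (-y) +ᵥ hw.toLp w) (𝓝 0)
      (𝓝 (DomAddAct.mk (-0 : E3) +ᵥ hw.toLp w)) := by
    have hc : Continuous (fun y : E3 => DomAddAct.mk (-y) +ᵥ hw.toLp w) := by
      have : Continuous (fun y : E3 => DomAddAct.mk (-y)) :=
        DomAddAct.continuous_mk.comp continuous_neg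
      exact this.vadd continuous_const
    exact hc.tendsto 0
  have h2 : DomAddAct.mk (-0 : E3) +ᵥ hw.toLp w = hw.toLp w := by
    simp
  rw [h2, tendsto_iff_edist_tendsto_0] at h1
  refine h1.congr fun y => ?_
  rw [DomAddAct.mk_vadd_toLp, Lp.edist_toLp_toLp]
  refine eLpNorm_congr_ae (.of_forall fun x => ?_)
  simp [sub_eq_neg_add]

/-- Convolution with a real bump function. -/
def mollify (η : ContDiffBump (0 : E3)) (w : E3 → ℂ) (x : E3) : ℂ :=
  ∫ s, w (x - s) * (η.normed volume s : ℂ)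

/-- The mollification error at x is the mean of w(x − s) − w(x) over a probability measure in s.
Jensen's inequality bounds its square by the mean square, and Tonelli reduces the L² norm to those
of the translation differences. -/
lemma eLpNorm_mollify_sub_le (η : ContDiffBump (0 : E3)) {w : E3 → ℂ}
    (hm : StronglyMeasurable w) (hw : MemLp w 2 volume) {ε : ℝ≥0∞}
    (h : ∀ y : E3, ‖y‖ < η.rOut → eLpNorm (fun x => w (x - y) - w x) 2 volume ≤ ε) :
    eLpNorm (fun x => mollify η w x - w x) 2 volume ≤ ε := by
  set k : E3 → ℝ≥0∞ := fun s => ENNReal.ofReal (η.normed volume s) with hk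
  have hkm : Measurable k := (η.continuous_normed.measurable).ennreal_ofReal
  set ν : Measure E3 := volume.withDensity k with hν
  have hk1 : ∫⁻ s, k s = 1 := by
    rw [← ofReal_integral_eq_lintegral_ofReal η.integrable_normed
      (.of_forall η.nonneg_normed), η.integral_normed, ENNReal.ofReal_one]
  have : IsProbabilityMeasure ν := ⟨by rw [hν, withDensity_apply _ .univ]; simpa using hk1⟩
  have hloc : LocallyIntegrable w volume := hw.locallyIntegrable (by norm_num)
  have hpt : ∀ x, ‖mollify η w x - w x‖ₑ ^ 2 ≤ ∫⁻ s, ‖w (x - s) - w x‖ₑ ^ 2 ∂ν := by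
    intro x
    have e1 : mollify η w x - w x = ∫ s, (w (x - s) - w x) * (η.normed volume s : ℂ) := by
      have i1 : Integrable (fun s => w (x - s) * (η.normed volume s : ℂ)) := by
        have := (HasCompactSupport.convolutionExists_left (ContinuousLinearMap.lsmul ℝ ℝ) (f := η.normed volume)
          (μ := volume) η.hasCompactSupport_normed η.continuous_normed hloc x)
        refine this.integrable.congr (.of_forall fun s => ?_)
        simp [mul_comm]
      have i2 : Integrable (fun s => w x * (η.normed volume s : ℂ)) :=
        (Integrable.ofReal (𝕜 := ℂ) (η.integrable_normed (μ := volume))).const_mul _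
      simp only [sub_mul]
      rw [integral_sub i1 i2, integral_const_mul, integral_complex_ofReal, η.integral_normed]
      simp [mollify]
    have e2 : ‖mollify η w x - w x‖ₑ ≤ ∫⁻ s, ‖w (x - s) - w x‖ₑ ∂ν := by
      rw [e1, hν, lintegral_withDensity_eq_lintegral_mul₀ hkm.aemeasurable]
      · refine (enorm_integral_le_lintegral_enorm _).trans (lintegral_mono fun s => ?_)
        simp only [Pi.mul_apply, enorm_mul, hk]
        rw [mul_comm]
        gcongr
        rw [← ofReal_norm, Complex.norm_real, Real.norm_of_nonneg (η.nonneg_normed s)]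
      · exact (((hm.comp_measurable (measurable_const.sub measurable_id)).sub
          stronglyMeasurable_const).enorm).aemeasurable
    have hsm : StronglyMeasurable fun s => w (x - s) - w x :=
      (hm.comp_measurable (measurable_const.sub measurable_id)).sub stronglyMeasurable_const
    -- Jensen's inequality, as monotonicity of Lᵖ norms for the probability measure ν.
    have e3 := eLpNorm_le_eLpNorm_of_exponent_le (μ := ν) (p := 1) (q := 2) (by norm_num)
      hsm.aestronglyMeasurable
    rw [eLpNorm_one_eq_lintegral_enorm] at e3
    calc ‖mollify η w x - w x‖ₑ ^ 2 ≤ (eLpNorm (fun s => w (x - s) - w x) 2 ν) ^ 2 := by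
          gcongr; exact e2.trans e3
      _ = _ := by
          have := eLpNorm_nnreal_pow_eq_lintegral (μ := ν) (f := fun s => w (x - s) - w x)
            (p := 2) (by norm_num)
          simpa using this
  have hsq : (eLpNorm (fun x => mollify η w x - w x) 2 volume) ^ 2 ≤ ε ^ 2 := by
    have := eLpNorm_nnreal_pow_eq_lintegral (μ := volume) (f := fun x => mollify η w x - w x)
            (p := 2) (by norm_num)
    simp only [NNReal.coe_ofNat, ENNReal.rpow_ofNat, ENNReal.coe_ofNat] at this
    rw [this]
    calc ∫⁻ x, ‖mollify η w x - w x‖ₑ ^ 2 ≤ ∫⁻ x, ∫⁻ s, ‖w (x - s) - w x‖ₑ ^ 2 ∂ν :=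
          lintegral_mono hpt
      _ = ∫⁻ s, (∫⁻ x, ‖w (x - s) - w x‖ₑ ^ 2) ∂ν := by
          refine lintegral_lintegral_swap (f := fun x s => ‖w (x - s) - w x‖ₑ ^ 2)
            (Measurable.aemeasurable ?_)
          refine Measurable.pow_const (StronglyMeasurable.enorm ?_) _
          exact (hm.comp_measurable (measurable_fst.sub measurable_snd)).sub
            (hm.comp_measurable measurable_fst)
      _ = ∫⁻ s, k s * ∫⁻ x, ‖w (x - s) - w x‖ₑ ^ 2 := by
          refine lintegral_withDensity_eq_lintegral_mul₀ hkm.aemeasurable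
            (g := fun s => ∫⁻ x, ‖w (x - s) - w x‖ₑ ^ 2) (Measurable.aemeasurable ?_)
          refine Measurable.lintegral_prod_left' (f := fun p : E3 × E3 => ‖w (p.1 - p.2) - w p.1‖ₑ ^ 2) ?_
          refine Measurable.pow_const (StronglyMeasurable.enorm ?_) _
          exact (hm.comp_measurable (measurable_fst.sub measurable_snd)).sub
            (hm.comp_measurable measurable_fst)
      _ ≤ ∫⁻ s, k s * ε ^ 2 := by
          refine lintegral_mono fun s => ?_
          by_cases hs : ‖s‖ < η.rOut
          · have := eLpNorm_nnreal_pow_eq_lintegral (μ := volume) (f := fun x => w (x - s) - w x)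
              (p := 2) (by norm_num)
            simp only [NNReal.coe_ofNat, ENNReal.rpow_ofNat, ENNReal.coe_ofNat] at this
            simp only
            rw [← this]
            gcongr
            exact h s hs
          · have : η.normed volume s = 0 := by
              have : s ∉ Function.support (η.normed volume) := by
                rw [η.support_normed_eq]; simpa using hs
              simpa using this
            simp [hk, this]
      _ = ε ^ 2 := by rw [lintegral_mul_const _ hkm, hk1, one_mul]
  exact (ENNReal.pow_le_pow_left_iff (by norm_num)).1 hsq

end

/-! ### Weak divergence on ℝ³ and its commutation with mollification -/

section
open Filter Topology ContDiff Convolution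

/-- The partial derivative of a function on `ℝ³`. -/
def pderiv (j : Fin 3) (f : E3 → ℂ) (x : E3) : ℂ := fderiv ℝ f x (e j)

/-- `div F = h` on all of `ℝ³` in the sense of distributions. -/
def IsWeakDiv (F : Fin 3 → E3 → ℂ) (h : E3 → ℂ) : Prop :=
  ∀ φ : E3 → ℂ, ContDiff ℝ ∞ φ → HasCompactSupport φ →
    ∑ j, ∫ x, F j x * pderiv j φ x = -∫ x, h x * φ x

/-- The bump function, complex valued. -/
def kernelC (η : ContDiffBump (0 : E3)) (s : E3) : ℂ := η.normed volume s

lemma contDiff_kernelC (η : ContDiffBump (0 : E3)) : ContDiff ℝ ∞ (kernelC η) :=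
  Complex.ofRealCLM.contDiff.comp η.contDiff_normed

lemma hasCompactSupport_kernelC (η : ContDiffBump (0 : E3)) : HasCompactSupport (kernelC η) :=
  η.hasCompactSupport_normed.comp_left (g := ((↑) : ℝ → ℂ)) Complex.ofReal_zero

lemma mollify_eq_convolution (η : ContDiffBump (0 : E3)) (w : E3 → ℂ) :
    mollify η w = (w ⋆[ContinuousLinearMap.mul ℝ ℂ, volume] kernelC η) := by
  ext x
  rw [convolution_eq_swap]
  rfl

lemma contDiff_mollify (η : ContDiffBump (0 : E3)) {w : E3 → ℂ} (hw : LocallyIntegrable w) :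
    ContDiff ℝ ∞ (mollify η w) := by
  rw [mollify_eq_convolution]
  exact (hasCompactSupport_kernelC η).contDiff_convolution_right _ hw (contDiff_kernelC η)

lemma fderiv_mollify (η : ContDiffBump (0 : E3)) {w : E3 → ℂ} (hw : LocallyIntegrable w)
    (x v : E3) :
    fderiv ℝ (mollify η w) x v = ∫ t, w t * fderiv ℝ (kernelC η) (x - t) v := by
  have hc := contDiff_kernelC η
  have hs := hasCompactSupport_kernelC η
  rw [mollify_eq_convolution, (hs.hasFDerivAt_convolution_right (ContinuousLinearMap.mul ℝ ℂ) hw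
    (hc.of_le (by simp)) x).fderiv, convolution_precompR_apply _ hw (hs.fderiv ℝ)
    (hc.continuous_fderiv (by simp))]
  rfl

/-- The reflected, translated kernel t ↦ η(x − t) is itself an admissible test function; the
reflection cancels the minus sign of the weak formulation. -/
lemma IsWeakDiv.sum_fderiv_mollify {F : Fin 3 → E3 → ℂ} {h : E3 → ℂ} (H : IsWeakDiv F h)
    (η : ContDiffBump (0 : E3)) (hF : ∀ j, LocallyIntegrable (F j)) (x : E3) :
    ∑ j, pderiv j (mollify η (F j)) x = mollify η h x := by
  have hc := contDiff_kernelC η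
  have hs := hasCompactSupport_kernelC η
  have hφ : ContDiff ℝ ∞ (fun t => kernelC η (x - t)) := hc.comp (contDiff_const.sub contDiff_id)
  have hφs : HasCompactSupport (fun t => kernelC η (x - t)) :=
    hs.comp_homeomorph (Homeomorph.subLeft x)
  have h1 := H _ hφ hφs
  have h2 : ∀ t v, fderiv ℝ (fun t => kernelC η (x - t)) t v = -fderiv ℝ (kernelC η) (x - t) v := by
    intro t v
    have hd : DifferentiableAt ℝ (kernelC η) (x - t) := (hc.differentiable (by simp)) _
    have := hd.hasFDerivAt.comp t ((hasFDerivAt_const x t).sub (hasFDerivAt_id t))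
    have h3 : HasFDerivAt (fun t => kernelC η (x - t)) _ t := this
    rw [h3.fderiv]
    simp
  simp only [pderiv, h2, mul_neg, integral_neg, Finset.sum_neg_distrib, neg_inj] at h1
  simp only [pderiv, fderiv_mollify η (hF _)]
  rw [h1, mollify_eq_convolution]
  rfl

lemma tsupport_mollify_subset (η : ContDiffBump (0 : E3)) {w : E3 → ℂ} {K : Set E3}
    (hw : ∀ x ∉ K, w x = 0) :
    tsupport (mollify η w) ⊆ Metric.cthickening η.rOut K := by
  refine closure_minimal ?_ Metric.isClosed_cthickening
  intro x hx
  rw [mollify_eq_convolution] at hx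
  obtain ⟨a, ha, b, hb, rfl⟩ := support_convolution_subset _ hx
  have haK : a ∈ K := by
    by_contra h
    exact ha (hw a h)
  have hb' : b ∈ Function.support (η.normed volume) := by
    intro h; exact hb (by simp [kernelC, h])
  rw [η.support_normed_eq] at hb'
  refine Metric.mem_cthickening_of_dist_le _ a _ _ haK ?_
  simpa [dist_eq_norm] using (mem_ball_zero_iff.1 hb').le

end

/-! ### Calculus of square integrable weak divergences -/

section
open Filter Topology ContDiff Convolution

lemma contDiff_pderiv {f : E3 → ℂ} (hf : ContDiff ℝ ∞ f) (j : Fin 3) : ContDiff ℝ ∞ (pderiv j f) :=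
  (hf.fderiv_right (m := ∞) (by simp)).clm_apply contDiff_const

lemma tsupport_pderiv_subset (f : E3 → ℂ) (j : Fin 3) : tsupport (pderiv j f) ⊆ tsupport f := by
  refine closure_minimal ?_ (isClosed_tsupport f)
  intro x hx
  refine support_fderiv_subset ℝ (f := f) ?_
  intro h
  exact hx (by simp [pderiv, h])

lemma hasCompactSupport_pderiv {f : E3 → ℂ} (hf : HasCompactSupport f) (j : Fin 3) :
    HasCompactSupport (pderiv j f) :=
  hf.of_isClosed_subset (isClosed_tsupport _) (tsupport_pderiv_subset f j)

lemma pderiv_mul {f g : E3 → ℂ} (hf : ContDiff ℝ ∞ f) (hg : ContDiff ℝ ∞ g) (j : Fin 3) (x : E3) :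
    pderiv j (fun y => f y * g y) x = pderiv j f x * g x + f x * pderiv j g x := by
  have h1 : DifferentiableAt ℝ f x := hf.differentiable (by simp) x
  have h2 : DifferentiableAt ℝ g x := hg.differentiable (by simp) x
  unfold pderiv
  rw [fderiv_fun_mul h1 h2]
  simp
  ring

/-- A square integrable function on `ℝ³` vanishing off `S`. -/
structure IsL2Off (S : Set E3) (f : E3 → ℂ) : Prop where
  meas : StronglyMeasurable f
  memLp : MemLp f 2 volume
  zero : ∀ x ∉ S, f x = 0

namespace IsL2Off
variable {S T : Set E3} {f g : E3 → ℂ}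

protected lemma add (hf : IsL2Off S f) (hg : IsL2Off S g) : IsL2Off S (f + g) :=
  ⟨hf.meas.add hg.meas, hf.memLp.add hg.memLp, fun x hx => by simp [hf.zero x hx, hg.zero x hx]⟩

protected lemma smul (c : ℂ) (hf : IsL2Off S f) : IsL2Off S (c • f) :=
  ⟨hf.meas.const_smul c, hf.memLp.const_smul c, fun x hx => by simp [hf.zero x hx]⟩

protected lemma zero' : IsL2Off S 0 :=
  ⟨stronglyMeasurable_zero, MemLp.zero, fun _ _ => rfl⟩

lemma mono (h : S ⊆ T) (hf : IsL2Off S f) : IsL2Off T f :=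
  ⟨hf.meas, hf.memLp, fun x hx => hf.zero x fun h' => hx (h h')⟩

protected lemma mul (hf : IsL2Off S f) (hg : ContDiff ℝ ∞ g) (hgs : HasCompactSupport g) :
    IsL2Off (S ∩ tsupport g) (g * f) := by
  refine ⟨hg.continuous.stronglyMeasurable.mul hf.meas, ?_, ?_⟩
  · exact hf.memLp.mul (p := ⊤) (hg.continuous.memLp_of_hasCompactSupport hgs)
  · intro x hx
    by_cases h : x ∈ S
    · have : x ∉ tsupport g := fun h' => hx ⟨h, h'⟩
      simp [image_eq_zero_of_notMem_tsupport this]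
    · simp [hf.zero x h]

lemma locallyIntegrable (hf : IsL2Off S f) : LocallyIntegrable f volume :=
  hf.memLp.locallyIntegrable (by norm_num)

lemma integrable_mul (hf : IsL2Off S f) (hg : ContDiff ℝ ∞ g) (hgs : HasCompactSupport g) :
    Integrable (fun x => f x * g x) :=
  hf.memLp.integrable_mul (q := 2) (hg.continuous.memLp_of_hasCompactSupport hgs)

lemma translate (hf : IsL2Off S f) (v : E3) :
    IsL2Off ((fun x => x - v) ⁻¹' S) (fun x => f (x - v)) :=
  ⟨hf.meas.comp_measurable (measurable_id.sub measurable_const),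
    hf.memLp.comp_measurePreserving (measurePreserving_sub_right volume v),
    fun _ hx => hf.zero _ hx⟩

end IsL2Off

/-- `div F = h` on `ℝ³` weakly, with square integrable `F` and `h` vanishing off `S`. -/
structure HasWeakDiv (S : Set E3) (F : Fin 3 → E3 → ℂ) (h : E3 → ℂ) : Prop where
  left : ∀ j, IsL2Off S (F j)
  right : IsL2Off S h
  div : IsWeakDiv F h

namespace HasWeakDiv
variable {S T : Set E3} {F G : Fin 3 → E3 → ℂ} {h k g : E3 → ℂ}

protected lemma add (H : HasWeakDiv S F h) (K : HasWeakDiv S G k) :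
    HasWeakDiv S (F + G) (h + k) := by
  refine ⟨fun j => (H.left j).add (K.left j), H.right.add K.right, fun φ hφ hs => ?_⟩
  have e1 : ∀ j, ∫ x, (F + G) j x * pderiv j φ x =
      (∫ x, F j x * pderiv j φ x) + ∫ x, G j x * pderiv j φ x := by
    intro j
    rw [← integral_add ((H.left j).integrable_mul (contDiff_pderiv hφ j)
      (hasCompactSupport_pderiv hs j)) ((K.left j).integrable_mul (contDiff_pderiv hφ j)
      (hasCompactSupport_pderiv hs j))]
    simp [add_mul]
  have e2 : ∫ x, (h + k) x * φ x = (∫ x, h x * φ x) + ∫ x, k x * φ x := by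
    rw [← integral_add (H.right.integrable_mul hφ hs) (K.right.integrable_mul hφ hs)]
    simp [add_mul]
  rw [e2, neg_add, ← H.div φ hφ hs, ← K.div φ hφ hs, ← Finset.sum_add_distrib]
  exact Finset.sum_congr rfl fun j _ => e1 j

protected lemma smul (c : ℂ) (H : HasWeakDiv S F h) : HasWeakDiv S (c • F) (c • h) := by
  refine ⟨fun j => (H.left j).smul c, H.right.smul c, fun φ hφ hs => ?_⟩
  simp only [Pi.smul_apply, smul_eq_mul, mul_assoc, integral_const_mul]
  rw [← Finset.mul_sum, H.div φ hφ hs, mul_neg]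

protected lemma zero : HasWeakDiv S 0 0 :=
  ⟨fun _ => .zero', .zero', fun φ _ _ => by simp⟩

protected lemma sum {ι : Type*} (s : Finset ι) {F : ι → Fin 3 → E3 → ℂ} {h : ι → E3 → ℂ}
    (H : ∀ i, HasWeakDiv S (F i) (h i)) : HasWeakDiv S (∑ i ∈ s, F i) (∑ i ∈ s, h i) := by
  classical
  induction s using Finset.induction_on with
  | empty => simpa using HasWeakDiv.zero
  | insert a s ha ih =>
    rw [Finset.sum_insert ha, Finset.sum_insert ha]
    exact (H a).add ih

lemma congr_left (H : HasWeakDiv S F h) (e : G = F) : HasWeakDiv S G h := e ▸ H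

lemma mono (hST : S ⊆ T) (H : HasWeakDiv S F h) : HasWeakDiv T F h :=
  ⟨fun j => (H.left j).mono hST, H.right.mono hST, H.div⟩

/-- Test the equation for F with gφ and use the product rule; the terms with the gradient of g move
to the right-hand side. -/
protected lemma mul (H : HasWeakDiv S F h) (hg : ContDiff ℝ ∞ g) (hgs : HasCompactSupport g) :
    HasWeakDiv (S ∩ tsupport g) (fun j => g * F j) (g * h + ∑ j, pderiv j g * F j) := by
  have hp : ∀ j, IsL2Off (S ∩ tsupport g) (pderiv j g * F j) := fun j =>
    ((H.left j).mul (contDiff_pderiv hg j) (hasCompactSupport_pderiv hgs j)).mono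
      (Set.inter_subset_inter_right _ (tsupport_pderiv_subset g j))
  have hsum : IsL2Off (S ∩ tsupport g) (∑ j, pderiv j g * F j) := by
    rw [Fin.sum_univ_three]
    exact ((hp 0).add (hp 1)).add (hp 2)
  refine ⟨fun j => (H.left j).mul hg hgs, (H.right.mul hg hgs).add hsum, fun φ hφ hs => ?_⟩
  have hgφ : ContDiff ℝ ∞ (fun y => g y * φ y) := hg.mul hφ
  have hgφs : HasCompactSupport (fun y => g y * φ y) := hs.mul_left
  have key := H.div _ hgφ hgφs
  have e1 : ∀ j, ∫ x, F j x * pderiv j (fun y => g y * φ y) x =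
      (∫ x, (pderiv j g * F j) x * φ x) + ∫ x, (g * F j) x * pderiv j φ x := by
    intro j
    rw [← integral_add ((hp j).integrable_mul hφ hs) (((H.left j).mul hg hgs).integrable_mul
      (contDiff_pderiv hφ j) (hasCompactSupport_pderiv hs j))]
    refine integral_congr_ae (.of_forall fun x => ?_)
    have := pderiv_mul hg hφ j x
    simp only [this, Pi.mul_apply]
    ring
  have e2 : ∫ x, (g * h + ∑ j, pderiv j g * F j) x * φ x =
      (∫ x, h x * (g x * φ x)) + ∑ j, ∫ x, (pderiv j g * F j) x * φ x := by
    rw [← integral_finsetSum _ fun j _ => (hp j).integrable_mul hφ hs,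
      ← integral_add (H.right.integrable_mul hgφ hgφs)
        (integrable_finsetSum _ fun j _ => (hp j).integrable_mul hφ hs)]
    refine integral_congr_ae (.of_forall fun x => ?_)
    simp only [Pi.add_apply, Pi.mul_apply, Finset.sum_apply, add_mul, Finset.sum_mul]
    ring
  simp only [e1, Finset.sum_add_distrib] at key
  rw [e2, neg_add, ← key]
  ring

lemma translate (H : HasWeakDiv S F h) (v : E3) :
    HasWeakDiv ((fun x => x - v) ⁻¹' S) (fun j x => F j (x - v)) (fun x => h (x - v)) := by
  refine ⟨fun j => (H.left j).translate v, H.right.translate v, fun φ hφ hs => ?_⟩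
  have hφ' : ContDiff ℝ ∞ (fun y => φ (y + v)) := hφ.comp (contDiff_id.add contDiff_const)
  have hs' : HasCompactSupport (fun y => φ (y + v)) := hs.comp_homeomorph (Homeomorph.addRight v)
  have key := H.div _ hφ' hs'
  have e1 : ∀ j, ∫ x, F j (x - v) * pderiv j φ x =
      ∫ x, F j x * pderiv j (fun y => φ (y + v)) x := by
    intro j
    rw [← integral_sub_right_eq_self (fun x => F j x * _) v]
    refine integral_congr_ae (.of_forall fun x => ?_)
    simp [pderiv, fderiv_comp_add_right]
  have e2 : ∫ x, h (x - v) * φ x = ∫ x, h x * φ (x + v) := by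
    rw [← integral_sub_right_eq_self (fun x => h x * _) v]
    simp
  rw [e2, ← key]
  exact Finset.sum_congr rfl fun j _ => e1 j

/-- The weak divergence is unique. -/
lemma ae_eq_zero (H : HasWeakDiv S 0 h) : h =ᵐ[volume] 0 := by
  refine ae_eq_zero_of_integral_contDiff_smul_eq_zero H.right.locallyIntegrable fun g hg hgs => ?_
  have hg' : ContDiff ℝ ∞ (fun x => (g x : ℂ)) := Complex.ofRealCLM.contDiff.comp hg
  have hgs' : HasCompactSupport (fun x => (g x : ℂ)) :=
    hgs.comp_left (g := ((↑) : ℝ → ℂ)) Complex.ofReal_zero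
  have := H.div _ hg' hgs'
  simp only [Pi.zero_apply, zero_mul, integral_zero, Finset.sum_const_zero, zero_eq_neg] at this
  rw [← this]
  refine integral_congr_ae (.of_forall fun x => ?_)
  simp [mul_comm]

end HasWeakDiv

end

/-! ### Fields on ℝ³ with L² gradient and L² image under Δ* -/

section
open Filter Topology ContDiff Convolution

/-- The stress tensor of a displacement gradient `D`. -/
def stressOf (lam mu : ℝ) (D : Fin 3 → Fin 3 → E3 → ℂ) (i : Fin 3) : Fin 3 → E3 → ℂ :=
  (lam : ℂ) • (Pi.single i (∑ k, D k k) : Fin 3 → E3 → ℂ) +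
    (mu : ℂ) • ∑ j, (Pi.single j (D i j + D j i) : Fin 3 → E3 → ℂ)

lemma stressOf_apply (lam mu : ℝ) (D : Fin 3 → Fin 3 → E3 → ℂ) (i j : Fin 3) :
    stressOf lam mu D i j =
      (if i = j then (lam : ℂ) • ∑ k, D k k else 0) + (mu : ℂ) • (D i j + D j i) := by
  simp only [stressOf, Pi.add_apply, Pi.smul_apply, Finset.sum_apply,
    Pi.single_apply]
  rw [Finset.sum_ite_eq]
  by_cases h : i = j
  · simp [h]
  · simp [h, Ne.symm h]

/-- `w` has a weak gradient and `Δ* w = L` on `ℝ³`, everything square integrable and vanishing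
off `S`. -/
def ExtField (lam mu : ℝ) (S : Set E3) (w L : Fin 3 → E3 → ℂ) : Prop :=
  ∃ D : Fin 3 → Fin 3 → E3 → ℂ, (∀ i j, HasWeakDiv S (Pi.single j (w i)) (D i j)) ∧
    ∀ i, HasWeakDiv S (stressOf lam mu D i) (L i)

variable {lam mu : ℝ} {S T : Set E3} {w w' L L' : Fin 3 → E3 → ℂ} {g : E3 → ℂ}

/-- A vector field with the single component f in direction j has divergence ∂_j f, so weak partial
derivatives are treated as weak divergences. This is the product rule for them. -/
lemma HasWeakDiv.single_mul {f d : E3 → ℂ} {j : Fin 3} (H : HasWeakDiv S (Pi.single j f) d)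
    (hg : ContDiff ℝ ∞ g) (hgs : HasCompactSupport g) :
    HasWeakDiv (S ∩ tsupport g) (Pi.single j (g * f)) (g * d + pderiv j g * f) := by
  have := H.mul hg hgs
  have e1 : (fun k => g * (Pi.single j f : Fin 3 → E3 → ℂ) k) = Pi.single j (g * f) := by
    ext k x
    by_cases h : k = j <;> simp [h]
  have e2 : ∑ k, pderiv k g * (Pi.single j f : Fin 3 → E3 → ℂ) k = pderiv j g * f := by
    rw [Finset.sum_eq_single j (fun k _ hk => by simp [hk]) (by simp)]
    simp
  rwa [e1, e2] at this

namespace ExtField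

lemma isL2Off_left (H : ExtField lam mu S w L) (i : Fin 3) : IsL2Off S (w i) := by
  obtain ⟨D, hD, -⟩ := H
  simpa using (hD i 0).left 0

lemma isL2Off_right (H : ExtField lam mu S w L) (i : Fin 3) : IsL2Off S (L i) := by
  obtain ⟨D, -, hL⟩ := H
  exact (hL i).right

lemma mono (hST : S ⊆ T) (H : ExtField lam mu S w L) : ExtField lam mu T w L := by
  obtain ⟨D, hD, hL⟩ := H
  exact ⟨D, fun i j => (hD i j).mono hST, fun i => (hL i).mono hST⟩

protected lemma add (H : ExtField lam mu S w L) (H' : ExtField lam mu S w' L') :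
    ExtField lam mu S (w + w') (L + L') := by
  obtain ⟨D, hD, hL⟩ := H
  obtain ⟨D', hD', hL'⟩ := H'
  refine ⟨D + D', fun i j => ?_, fun i => ?_⟩
  · have := (hD i j).add (hD' i j)
    rwa [← Pi.single_add] at this
  · have := (hL i).add (hL' i)
    refine this.congr_left ?_
    ext j x
    simp only [Pi.add_apply, stressOf_apply, Finset.sum_add_distrib, Pi.smul_apply, smul_eq_mul]
    split_ifs
    · simp only [Pi.smul_apply, Pi.add_apply, smul_eq_mul]; ring
    · simp only [Pi.zero_apply]; ring

protected lemma smul (c : ℂ) (H : ExtField lam mu S w L) :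
    ExtField lam mu S (c • w) (c • L) := by
  obtain ⟨D, hD, hL⟩ := H
  refine ⟨c • D, fun i j => ?_, fun i => ?_⟩
  · have := (hD i j).smul c
    rwa [← Pi.single_smul] at this
  · have := (hL i).smul c
    refine this.congr_left ?_
    ext j x
    simp only [stressOf_apply, Pi.add_apply, Pi.smul_apply, smul_eq_mul, ← Finset.smul_sum]
    split_ifs
    · simp only [Pi.smul_apply, smul_eq_mul]; ring
    · simp only [Pi.zero_apply]; ring

protected lemma sub (H : ExtField lam mu S w L) (H' : ExtField lam mu S w' L') :
    ExtField lam mu S (w - w') (L - L') := by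
  have := H.add (H'.smul (-1))
  simpa [sub_eq_add_neg] using this

/-- The stress of gw is g times the stress of w plus products of first derivatives of g with w, and
all of these have L² weak divergence. The resulting value of Δ*(gw) is never needed explicitly. -/
lemma mul (H : ExtField lam mu S w L) (hg : ContDiff ℝ ∞ g) (hgs : HasCompactSupport g) :
    ∃ L', ExtField lam mu (S ∩ tsupport g) (fun i => g * w i) L' := by
  obtain ⟨D, hD, hL⟩ := H
  have hsub : ∀ j, S ∩ tsupport (pderiv j g) ⊆ S ∩ tsupport g := fun j =>
    Set.inter_subset_inter_right _ (tsupport_pderiv_subset g j)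
  have h1 : ∀ i j l, ∃ d, HasWeakDiv (S ∩ tsupport g) (Pi.single j (pderiv l g * w i)) d :=
    fun i j l => ⟨_, ((hD i j).single_mul (contDiff_pderiv hg l)
      (hasCompactSupport_pderiv hgs l)).mono (hsub l)⟩
  choose d hd using h1
  have h2 : ∀ i, ∃ l, HasWeakDiv (S ∩ tsupport g)
      (stressOf lam mu (fun i j => g * D i j + pderiv j g * w i) i) l := by
    intro i
    have a1 := (hL i).mul hg hgs
    have a2 := (HasWeakDiv.sum Finset.univ (fun k => hd k i k)).smul (lam : ℂ)
    have a3 := (HasWeakDiv.sum Finset.univ (fun j => (hd i j j).add (hd j j i))).smul (mu : ℂ)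
    have a4 := a1.add (a2.add a3)
    refine ⟨_, a4.congr_left ?_⟩
    ext j x
    simp only [stressOf_apply, Pi.add_apply, Pi.smul_apply, Finset.sum_apply, Pi.mul_apply,
      Pi.single_apply, ← Pi.single_add, smul_eq_mul]
    by_cases h : i = j
    · subst h
      simp [Finset.sum_add_distrib, ← Finset.mul_sum, ite_apply]
      ring
    · simp [h, Ne.symm h, ite_apply]
      ring
  choose l hl using h2
  exact ⟨l, _, fun i j => (hD i j).single_mul hg hgs, hl⟩

lemma translate (H : ExtField lam mu S w L) (v : E3) :
    ExtField lam mu ((fun x => x - v) ⁻¹' S) (fun i x => w i (x - v)) (fun i x => L i (x - v)) := by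
  obtain ⟨D, hD, hL⟩ := H
  refine ⟨fun i j x => D i j (x - v), fun i j => ?_, fun i => ?_⟩
  · convert (hD i j).translate v using 1
    ext k x
    by_cases h : k = j
    · subst h; simp
    · simp [h]
  · convert (hL i).translate v using 1
    ext j x
    simp only [stressOf_apply]
    split_ifs <;> simp

/-- Uniqueness of weak derivatives, applied to the gradient and then to the divergence of the
stress. -/
lemma right_ae_zero (H : ExtField lam mu S 0 L) (i : Fin 3) : L i =ᵐ[volume] 0 := by
  obtain ⟨D, hD, hL⟩ := H
  have h0 : ∀ i j, D i j =ᵐ[volume] 0 := fun i j => by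
    have := hD i j
    simp only [Pi.zero_apply, Pi.single_zero] at this
    exact this.ae_eq_zero
  have h1 : ∀ j, stressOf lam mu D i j =ᵐ[volume] 0 := by
    intro j
    filter_upwards [h0 0 0, h0 1 1, h0 2 2, h0 i j, h0 j i] with x a0 a1 a2 a3 a4
    rw [stressOf_apply]
    split_ifs <;> simp [Fin.sum_univ_three, a0, a1, a2, a3, a4]
  refine HasWeakDiv.ae_eq_zero (S := S) ⟨fun j => .zero', (hL i).right, fun φ hφ hs => ?_⟩
  rw [← (hL i).div φ hφ hs]
  refine Finset.sum_congr rfl fun j _ => integral_congr_ae ?_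
  filter_upwards [h1 j] with x hx
  simp [hx]

end ExtField

end

/-! ### Approximation by test fields: compact support -/

section
open Filter Topology ContDiff Convolution

variable {Ω : Opens E3} {lam mu : ℝ} {S T : Set E3} {w w' L L' : Fin 3 → E3 → ℂ} {g : E3 → ℂ}

/-- `(w, L)` is a limit in `L²` of pairs `(φ, Δ* φ)` with test fields `φ`. -/
def TestApprox (Ω : Opens E3) (lam mu : ℝ) (w L : Fin 3 → E3 → ℂ) : Prop :=
  ∀ ε : ℝ≥0∞, 0 < ε → ∃ Φ : Fin 3 → 𝓓(Ω, ℂ), ∀ i,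
    eLpNorm (⇑(Φ i) - w i) 2 volume ≤ ε ∧ eLpNorm (⇑(lameTest lam mu Φ i) - L i) 2 volume ≤ ε

lemma memLp_test (φ : 𝓓(Ω, ℂ)) : MemLp φ 2 volume :=
  φ.continuous.memLp_of_hasCompactSupport φ.hasCompactSupport

lemma lineDeriv_test_add (φ χ : 𝓓(Ω, ℂ)) (v : E3) :
    (∂_{v} (φ + χ) : 𝓓(Ω, ℂ)) = ∂_{v} φ + ∂_{v} χ := by
  simp only [TestFunction.lineDerivOp_eq_lineDerivCLM ℝ, map_add]

lemma lameTest_add (Φ Ψ : Fin 3 → 𝓓(Ω, ℂ)) (i : Fin 3) :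
    lameTest lam mu (Φ + Ψ) i = lameTest lam mu Φ i + lameTest lam mu Ψ i := by
  simp only [lameTest, Pi.add_apply, lineDeriv_test_add, Finset.sum_add_distrib, smul_add]
  abel

lemma TestApprox.add (H : TestApprox Ω lam mu w L) (H' : TestApprox Ω lam mu w' L')
    (hw : ∀ i, IsL2Off S (w i)) (hw' : ∀ i, IsL2Off S (w' i))
    (hL : ∀ i, IsL2Off S (L i)) (hL' : ∀ i, IsL2Off S (L' i)) :
    TestApprox Ω lam mu (w + w') (L + L') := by
  intro ε hε
  obtain ⟨Φ, hΦ⟩ := H (ε / 2) (ENNReal.half_pos hε.ne')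
  obtain ⟨Ψ, hΨ⟩ := H' (ε / 2) (ENNReal.half_pos hε.ne')
  have key : ∀ (φ χ : 𝓓(Ω, ℂ)) {a b : E3 → ℂ}, IsL2Off S a → IsL2Off S b →
      eLpNorm (⇑φ - a) 2 volume ≤ ε / 2 → eLpNorm (⇑χ - b) 2 volume ≤ ε / 2 →
      eLpNorm (⇑(φ + χ) - (a + b)) 2 volume ≤ ε := by
    intro φ χ a b ha hb h1 h2
    have e : (⇑(φ + χ) - (a + b) : E3 → ℂ) = (⇑φ - a) + (⇑χ - b) := by
      ext x; simp; ring
    rw [e, ← ENNReal.add_halves ε]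
    exact (eLpNorm_add_le ((memLp_test φ).sub ha.memLp).1 ((memLp_test χ).sub hb.memLp).1
      (by norm_num)).trans (add_le_add h1 h2)
  refine ⟨Φ + Ψ, fun i => ⟨key _ _ (hw i) (hw' i) (hΦ i).1 (hΨ i).1, ?_⟩⟩
  rw [lameTest_add]
  exact key _ _ (hL i) (hL' i) (hΦ i).2 (hΨ i).2

/-- Limits of approximable pairs are approximable. The set T may differ from S because the
approximants will be translates. -/
lemma TestApprox.of_forall (hw : ∀ i, IsL2Off S (w i)) (hL : ∀ i, IsL2Off S (L i))
    (H : ∀ ε : ℝ≥0∞, 0 < ε → ∃ w' L', TestApprox Ω lam mu w' L' ∧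
      ∀ i, (IsL2Off T (w' i) ∧ IsL2Off T (L' i)) ∧
        eLpNorm (w' i - w i) 2 volume ≤ ε ∧ eLpNorm (L' i - L i) 2 volume ≤ ε) :
    TestApprox Ω lam mu w L := by
  intro ε hε
  obtain ⟨w', L', h1, h2⟩ := H (ε / 2) (ENNReal.half_pos hε.ne')
  obtain ⟨Φ, hΦ⟩ := h1 (ε / 2) (ENNReal.half_pos hε.ne')
  have key : ∀ (φ : 𝓓(Ω, ℂ)) {a b : E3 → ℂ}, IsL2Off S a → IsL2Off T b →
      eLpNorm (⇑φ - b) 2 volume ≤ ε / 2 → eLpNorm (b - a) 2 volume ≤ ε / 2 →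
      eLpNorm (⇑φ - a) 2 volume ≤ ε := by
    intro φ a b ha hb h1 h2
    have e : (⇑φ - a : E3 → ℂ) = (⇑φ - b) + (b - a) := by simp
    rw [e, ← ENNReal.add_halves ε]
    exact (eLpNorm_add_le ((memLp_test φ).sub hb.memLp).1 (hb.memLp.sub ha.memLp).1
      (by norm_num)).trans (add_le_add h1 h2)
  exact ⟨Φ, fun i => ⟨key _ (hw i) (h2 i).1.1 (hΦ i).1 (h2 i).2.1,
    key _ (hL i) (h2 i).1.2 (hΦ i).2 (h2 i).2.2⟩⟩

lemma mollify_add (η : ContDiffBump (0 : E3)) {f g : E3 → ℂ} (hf : LocallyIntegrable f)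
    (hg : LocallyIntegrable g) : mollify η (f + g) = mollify η f + mollify η g := by
  simp only [mollify_eq_convolution]
  have hc := (contDiff_kernelC η).continuous
  have hs := hasCompactSupport_kernelC η
  exact ConvolutionExists.add_distrib (hs.convolutionExists_right _ hf hc)
    (hs.convolutionExists_right _ hg hc)

lemma mollify_smul (η : ContDiffBump (0 : E3)) (c : ℂ) (f : E3 → ℂ) :
    mollify η (c • f) = c • mollify η f := by
  ext x
  simp [mollify, mul_assoc, integral_const_mul]

lemma mollify_zero (η : ContDiffBump (0 : E3)) : mollify η 0 = 0 := by
  ext x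
  simp [mollify]

lemma coe_lineDeriv_test (φ : 𝓓(Ω, ℂ)) (j : Fin 3) :
    ((∂_{e j} φ : 𝓓(Ω, ℂ)) : E3 → ℂ) = pderiv j φ := by
  ext x
  exact lineDeriv_test_apply φ (e j) x

/-- `Δ* φ` is the divergence of the stress tensor of `φ`. -/
lemma lameTest_eq_sum_lineDeriv (Φ : Fin 3 → 𝓓(Ω, ℂ)) (i : Fin 3) :
    lameTest lam mu Φ i = ∑ j, ∂_{e j} ((if i = j then lam • ∑ k, ∂_{e k} (Φ k) else 0) +
      mu • (∂_{e j} (Φ i) + ∂_{e i} (Φ j)) : 𝓓(Ω, ℂ)) := by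
  have h3 : ∀ (c : ℝ) (φ : 𝓓(Ω, ℂ)) (v : E3), (∂_{v} (c • φ) : 𝓓(Ω, ℂ)) = c • ∂_{v} φ := by
    intro c φ v
    simp only [TestFunction.lineDerivOp_eq_lineDerivCLM ℝ, map_smul]
  have h4 : ∀ v : E3, (∂_{v} (0 : 𝓓(Ω, ℂ)) : 𝓓(Ω, ℂ)) = 0 := by
    intro v
    simp only [TestFunction.lineDerivOp_eq_lineDerivCLM ℝ, map_zero]
  have h5 : ∀ j, (∂_{e j} ((if i = j then lam • ∑ k, ∂_{e k} (Φ k) else 0) : 𝓓(Ω, ℂ)) : 𝓓(Ω, ℂ)) =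
      if i = j then lam • ∑ k, ∂_{e i} (∂_{e k} (Φ k)) else 0 := by
    intro j
    split_ifs with h
    · subst h; simp [h3, Fin.sum_univ_three, lineDeriv_test_add]
    · exact h4 _
  simp only [lineDeriv_test_add, h3, h5, Finset.sum_add_distrib, Finset.sum_ite_eq,
    Finset.mem_univ, if_true, lameTest, ← Finset.smul_sum, smul_add, add_smul]
  simp only [lineDeriv_comm_test _ (e i)]
  abel

/-- Δ* has constant coefficients, so it commutes with mollification: once for the gradient, once for
the divergence of the stress. -/
lemma lameTest_eq_mollify {η : ContDiffBump (0 : E3)} (H : ExtField lam mu S w L)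
    {Φ : Fin 3 → 𝓓(Ω, ℂ)} (hΦ : ∀ i, (Φ i : E3 → ℂ) = mollify η (w i)) (i : Fin 3) :
    (lameTest lam mu Φ i : E3 → ℂ) = mollify η (L i) := by
  obtain ⟨D, hD, hL⟩ := H
  have h1 : ∀ i j, ((∂_{e j} (Φ i) : 𝓓(Ω, ℂ)) : E3 → ℂ) = mollify η (D i j) := by
    intro i j
    ext x
    rw [coe_lineDeriv_test, ← (hD i j).div.sum_fderiv_mollify η
      (fun k => ((hD i j).left k).locallyIntegrable), Finset.sum_eq_single j, hΦ]
    · simp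
    · intro k _ hk
      have : mollify η ((Pi.single j (w i) : Fin 3 → E3 → ℂ) k) = 0 := by
        simp [hk, mollify_zero]
      rw [this]
      simp [pderiv]
    · simp
  have hDl : ∀ i j, LocallyIntegrable (D i j) volume := fun i j => (hD i j).right.locallyIntegrable
  have h2 : ∀ j, mollify η (stressOf lam mu D i j) = 
      ((((if i = j then lam • ∑ k, ∂_{e k} (Φ k) else 0) +
        mu • (∂_{e j} (Φ i) + ∂_{e i} (Φ j))) : 𝓓(Ω, ℂ)) : E3 → ℂ) := by
    intro j
    have a1 : mollify η ((mu : ℂ) • (D i j + D j i)) =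
        (mu : ℂ) • (mollify η (D i j) + mollify η (D j i)) := by
      rw [mollify_smul, mollify_add η (hDl _ _) (hDl _ _)]
    have a2 : mollify η (∑ k, D k k) = ∑ k, mollify η (D k k) := by
      simp only [Fin.sum_univ_three]
      rw [mollify_add η ((hDl _ _).add (hDl _ _)) (hDl _ _), mollify_add η (hDl _ _) (hDl _ _)]
    have a3 : LocallyIntegrable ((mu : ℂ) • (D i j + D j i)) volume :=
      ((hDl _ _).add (hDl _ _)).smul _
    have a4 : LocallyIntegrable (if i = j then (lam : ℂ) • ∑ k, D k k else 0) volume := by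
      split_ifs
      · rw [Fin.sum_univ_three]
        exact (((hDl _ _).add (hDl _ _)).add (hDl _ _)).smul _
      · exact locallyIntegrable_zero
    rw [stressOf_apply, mollify_add η a4 a3, a1]
    by_cases h : i = j
    · rw [if_pos h, if_pos h, mollify_smul, a2]
      ext x
      simp [← h1, Fin.sum_univ_three]
    · rw [if_neg h, if_neg h, mollify_zero]
      ext x
      simp [← h1]
  ext x
  rw [← (hL i).div.sum_fderiv_mollify η (fun k => ((hL i).left k).locallyIntegrable)]
  simp only [h2, ← coe_lineDeriv_test]
  rw [lameTest_eq_sum_lineDeriv]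
  simp [Fin.sum_univ_three]

/-- Mollify at a scale smaller than the room that K has inside Ω. -/
lemma ExtField.testApprox_of_isCompact {K : Set E3} (hK : IsCompact K) (hKΩ : K ⊆ Ω)
    (H : ExtField lam mu K w L) : TestApprox Ω lam mu w L := by
  intro ε hε
  obtain ⟨δ, hδ, hδΩ⟩ := hK.exists_cthickening_subset_open Ω.isOpen hKΩ
  have hev : ∀ᶠ y : E3 in 𝓝 0, (∀ i, eLpNorm (fun x => w i (x - y) - w i x) 2 volume ≤ ε) ∧
      ∀ i, eLpNorm (fun x => L i (x - y) - L i x) 2 volume ≤ ε := by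
    refine (eventually_all.2 fun i => ?_).and (eventually_all.2 fun i => ?_)
    · exact (tendsto_eLpNorm_translate_sub (H.isL2Off_left i).memLp).eventually_le_const hε
    · exact (tendsto_eLpNorm_translate_sub (H.isL2Off_right i).memLp).eventually_le_const hε
  obtain ⟨r, hr, hball⟩ := Metric.eventually_nhds_iff_ball.1 hev
  have hmin : 0 < min δ r := lt_min hδ hr
  let η : ContDiffBump (0 : E3) := ⟨min δ r / 2, min δ r, by positivity, by linarith⟩
  have hsupp : ∀ i, tsupport (mollify η (w i)) ⊆ Metric.cthickening δ K := fun i =>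
    (tsupport_mollify_subset η (H.isL2Off_left i).zero).trans
      (Metric.cthickening_mono (min_le_left _ _) _)
  let Φ : Fin 3 → 𝓓(Ω, ℂ) := fun i =>
    ⟨mollify η (w i), contDiff_mollify η (H.isL2Off_left i).locallyIntegrable,
      (hK.cthickening (r := δ)).of_isClosed_subset (isClosed_tsupport _) (hsupp i),
      (hsupp i).trans hδΩ⟩
  have hy : ∀ y : E3, ‖y‖ < η.rOut → y ∈ Metric.ball (0 : E3) r := fun y hy => by
    rw [mem_ball_zero_iff]
    exact hy.trans_le (min_le_right _ _)
  refine ⟨Φ, fun i => ⟨?_, ?_⟩⟩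
  · exact eLpNorm_mollify_sub_le η (H.isL2Off_left i).meas (H.isL2Off_left i).memLp
      fun y h => (hball y (hy y h)).1 i
  · rw [lameTest_eq_mollify (η := η) H (fun _ => rfl)]
    exact eLpNorm_mollify_sub_le η (H.isL2Off_right i).meas (H.isL2Off_right i).memLp
      fun y h => (hball y (hy y h)).2 i

end

/-! ### Approximation by test fields: segment property and localisation -/

section
open Filter Topology ContDiff Convolution

variable {Ω : Opens E3} {lam mu : ℝ} {S T : Set E3} {w w' L L' : Fin 3 → E3 → ℂ} {g : E3 → ℂ}

/-- The segment property of a domain with `C²` boundary. -/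
lemma HasC2Boundary.exists_translation (hΩ : HasC2Boundary Ω) {x : E3}
    (hx : x ∈ closure (Ω : Set E3)) :
    ∃ r > 0, ∃ v : E3, ∀ᶠ t : ℝ in 𝓝[>] 0,
      ∀ y ∈ closure (Ω : Set E3) ∩ Metric.closedBall x r, y + t • v ∈ Ω := by
  by_cases hxΩ : x ∈ Ω
  · obtain ⟨r, hr, h⟩ := Metric.nhds_basis_closedBall.mem_iff.1 (Ω.isOpen.mem_nhds hxΩ)
    exact ⟨r, hr, 0, .of_forall fun t y hy => by simpa using h hy.2⟩
  have hxf : x ∈ frontier (Ω : Set E3) := ⟨hx, by rwa [Ω.isOpen.interior_eq]⟩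
  obtain ⟨W, hW, hxW, ψ, hψ, hψ', -, hiff⟩ := hΩ x hxf
  have hcd : ContDiffAt ℝ 2 ψ x := hψ.contDiffAt (hW.mem_nhds hxW)
  have hstrict : HasStrictFDerivAt ψ (fderiv ℝ ψ x) x := hcd.hasStrictFDerivAt (by simp)
  obtain ⟨v, hv⟩ : ∃ v, fderiv ℝ ψ x v < 0 := by
    obtain ⟨v, hv⟩ : ∃ v, fderiv ℝ ψ x v ≠ 0 := by
      by_contra! h
      exact hψ' x hxW (ContinuousLinearMap.ext h)
    rcases lt_or_gt_of_ne hv with h | h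
    · exact ⟨v, h⟩
    · exact ⟨-v, by simpa using h⟩
  have hv0 : 0 < ‖v‖ := by
    rw [norm_pos_iff]; rintro rfl; simp at hv
  -- Half of the decrease rate along v: strict differentiability bounds the linearisation error by
  -- c‖tv‖, so ψ(y + tv) ≤ ψ(y) + (t/2)dψ(v) < 0, uniformly in y near x.
  set c : ℝ := -fderiv ℝ ψ x v / (2 * ‖v‖) with hc
  have hcpos : 0 < c := by have : 0 < -fderiv ℝ ψ x v := by linarith
                           positivity
  have hcv : c * ‖v‖ = -fderiv ℝ ψ x v / 2 := by rw [hc]; field_simp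
  have hev := hstrict.isLittleO.def hcpos
  rw [nhds_prod_eq, eventually_prod_self_iff'] at hev
  obtain ⟨s, hs, hev⟩ := hev
  obtain ⟨r, hr, hrs⟩ := Metric.nhds_basis_ball.mem_iff.1 (inter_mem hs (hW.mem_nhds hxW))
  refine ⟨r / 2, by positivity, v, ?_⟩
  have ht : ∀ᶠ t : ℝ in 𝓝[>] 0, t * ‖v‖ < r / 2 := by
    have : Tendsto (fun t : ℝ => t * ‖v‖) (𝓝[>] 0) (𝓝 (0 * ‖v‖)) :=
      (tendsto_id.mul_const _).mono_left nhdsWithin_le_nhds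
    rw [zero_mul] at this
    exact this.eventually_lt_const (by positivity)
  filter_upwards [ht, self_mem_nhdsWithin] with t ht ht0 y ⟨hyc, hyr⟩
  have ht0 : 0 < t := ht0
  have hy1 : y ∈ Metric.ball x r := by
    rw [Metric.mem_closedBall] at hyr
    rw [Metric.mem_ball]; linarith
  have hy2 : y + t • v ∈ Metric.ball x r := by
    rw [Metric.mem_closedBall] at hyr
    rw [Metric.mem_ball]
    calc dist (y + t • v) x ≤ dist (y + t • v) y + dist y x := dist_triangle _ _ _
      _ = t * ‖v‖ + dist y x := by simp [norm_smul, abs_of_pos ht0]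
      _ < r := by linarith
  have hyW := (hrs hy1).2
  have hψy : ψ y ≤ 0 := by
    by_contra! h
    have hcont : ContinuousAt ψ y := (hψ.contDiffAt (hW.mem_nhds hyW)).continuousAt
    obtain ⟨z, ⟨hz1, hz2⟩, hz3⟩ := mem_closure_iff_nhds.1 hyc _
      (inter_mem (hcont.eventually_const_lt h) (hW.mem_nhds hyW))
    exact absurd ((hiff z hz2).1 hz3) (not_lt.2 (le_of_lt hz1))
  have hest := hev _ (hrs hy2).1 _ (hrs hy1).1
  refine (hiff _ (hrs hy2).2).2 ?_
  simp only [add_sub_cancel_left, map_smul, smul_eq_mul, norm_smul, Real.norm_eq_abs,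
    abs_of_pos ht0] at hest
  have := (abs_le.1 hest).2
  nlinarith

/-- A small translation along v moves the compact support of gw into Ω and changes gw and its Δ*
little in L². The translate then has compact support in Ω and can be mollified. -/
lemma ExtField.testApprox_mul
    (H : ExtField lam mu Ω w L) {x v : E3} {r : ℝ}
    (hv : ∀ᶠ t : ℝ in 𝓝[>] 0,
      ∀ y ∈ closure (Ω : Set E3) ∩ Metric.closedBall x r, y + t • v ∈ Ω)
    (hg : ContDiff ℝ ∞ g) (hgs : HasCompactSupport g) (hgr : tsupport g ⊆ Metric.closedBall x r) :
    ∃ L', ExtField lam mu Ω (fun i => g * w i) L' ∧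
      TestApprox Ω lam mu (fun i => g * w i) L' := by
  obtain ⟨L', hL'⟩ := H.mul hg hgs
  refine ⟨L', hL'.mono Set.inter_subset_left, ?_⟩
  set K : Set E3 := closure (Ω : Set E3) ∩ Metric.closedBall x r with hKdef
  have hK : IsCompact K := (isCompact_closedBall x r).inter_left isClosed_closure
  have hKf : ExtField lam mu K (fun i => g * w i) L' :=
    hL'.mono (Set.inter_subset_inter subset_closure hgr)
  refine TestApprox.of_forall (S := K) (T := Set.univ) hKf.isL2Off_left hKf.isL2Off_right ?_
  intro ε hε
  have htend : Tendsto (fun t : ℝ => t • v) (𝓝[>] 0) (𝓝 0) := by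
    have : Tendsto (fun t : ℝ => t • v) (𝓝[>] 0) (𝓝 ((0 : ℝ) • v)) :=
      (tendsto_id.smul_const v).mono_left nhdsWithin_le_nhds
    rwa [zero_smul] at this
  have hev : ∀ᶠ y : E3 in 𝓝 0,
      (∀ i, eLpNorm (fun x => (g * w i) (x - y) - (g * w i) x) 2 volume ≤ ε) ∧
      ∀ i, eLpNorm (fun x => L' i (x - y) - L' i x) 2 volume ≤ ε := by
    refine (eventually_all.2 fun i => ?_).and (eventually_all.2 fun i => ?_)
    · exact (tendsto_eLpNorm_translate_sub (hKf.isL2Off_left i).memLp).eventually_le_const hε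
    · exact (tendsto_eLpNorm_translate_sub (hKf.isL2Off_right i).memLp).eventually_le_const hε
  obtain ⟨t, ht1, ht2⟩ := (hv.and (htend.eventually hev)).exists
  have hT := hKf.translate (t • v)
  refine ⟨_, _, hT.testApprox_of_isCompact ?_ ?_, fun i => ⟨⟨?_, ?_⟩, ht2.1 i, ht2.2 i⟩⟩
  · exact (Homeomorph.subRight (t • v)).isCompact_preimage.2 hK
  · intro z hz
    simpa using ht1 _ hz
  · exact (hT.mono (Set.subset_univ _)).isL2Off_left i
  · exact (hT.mono (Set.subset_univ _)).isL2Off_right i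

/-- Test fields are dense in the fields whose extension by zero is admissible. -/
theorem ExtField.testApprox (hbdd : Bornology.IsBounded (Ω : Set E3)) (hΩ : HasC2Boundary Ω)
    (H : ExtField lam mu Ω w L) : TestApprox Ω lam mu w L := by
  have hcomp : IsCompact (closure (Ω : Set E3)) := hbdd.isCompact_closure
  -- Compactness induction in place of a partition of unity: on good sets S some g vanishes while w
  -- − gw is approximable for every admissible w. Unions multiply the functions g, and near a point
  -- g is 1 minus a cut-off.
  have main : ∃ g : E3 → ℂ, (∀ x ∈ closure (Ω : Set E3), g x = 0) ∧
      ∀ w L, ExtField lam mu Ω w L → ∃ L', ExtField lam mu Ω (fun i => g * w i) L' ∧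
        TestApprox Ω lam mu (w - fun i => g * w i) (L - L') := by
    refine hcomp.induction_on (p := fun S => ∃ g : E3 → ℂ, (∀ x ∈ S, g x = 0) ∧
      ∀ w L, ExtField lam mu Ω w L → ∃ L', ExtField lam mu Ω (fun i => g * w i) L' ∧
        TestApprox Ω lam mu (w - fun i => g * w i) (L - L')) ?_ ?_ ?_ ?_
    · refine ⟨1, by simp, fun w L h => ⟨L, by simpa using h, fun ε hε => ⟨0, fun i => ?_⟩⟩⟩
      have h0 : ((0 : 𝓓(Ω, ℂ)) : E3 → ℂ) = 0 := rfl
      have h1 : lameTest lam mu (0 : Fin 3 → 𝓓(Ω, ℂ)) i = 0 := by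
        simp [lameTest, TestFunction.lineDerivOp_eq_lineDerivCLM ℝ]
      simp [h0, h1]
    · rintro S T hST ⟨g, hg, h⟩
      exact ⟨g, fun x hx => hg x (hST hx), h⟩
    · rintro S T ⟨g, hg, h⟩ ⟨k, hk, h'⟩
      refine ⟨g * k, ?_, fun w L hw => ?_⟩
      · rintro x (hx | hx)
        · simp [hg x hx]
        · simp [hk x hx]
      · obtain ⟨L1, h1, a1⟩ := h' w L hw
        obtain ⟨L2, h2, a2⟩ := h _ _ h1
        have e1 : (fun i => g * (k * w i)) = fun i => g * k * w i := by
          funext i; rw [mul_assoc]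
        rw [e1] at h2 a2
        refine ⟨L2, h2, ?_⟩
        have := a1.add a2 (hw.sub h1).isL2Off_left (h1.sub h2).isL2Off_left
          (hw.sub h1).isL2Off_right (h1.sub h2).isL2Off_right
        simpa using this
    · intro x hx
      obtain ⟨r, hr, v, hv⟩ := hΩ.exists_translation hx
      let f : ContDiffBump x := ⟨r / 2, r, by positivity, by linarith⟩
      refine ⟨Metric.closedBall x (r / 2), mem_nhdsWithin_of_mem_nhds
        (Metric.closedBall_mem_nhds x (by positivity)), fun y => 1 - (f y : ℂ), fun y hy => ?_,
        fun w L hw => ?_⟩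
      · have : f y = 1 := f.one_of_mem_closedBall hy
        simp [this]
      · have hf : ContDiff ℝ ∞ (fun y => (f y : ℂ)) := Complex.ofRealCLM.contDiff.comp f.contDiff
        have hfs : tsupport (fun y => (f y : ℂ)) ⊆ Metric.closedBall x r := by
          refine closure_minimal (fun y hy => ?_) Metric.isClosed_closedBall
          have : y ∈ Function.support f := fun h => hy (by simp [h])
          rw [f.support_eq] at this
          exact Metric.ball_subset_closedBall this
        have hfc : HasCompactSupport (fun y => (f y : ℂ)) :=
          (isCompact_closedBall x r).of_isClosed_subset (isClosed_tsupport _) hfs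
        obtain ⟨L', h1, h2⟩ := hw.testApprox_mul hv hf hfc hfs
        have e1 : (w - fun i => (fun y => (f y : ℂ)) * w i) =
            fun i => (fun y => 1 - (f y : ℂ)) * w i := by
          ext i y
          simp only [Pi.sub_apply, Pi.mul_apply]
          ring
        refine ⟨L - L', by rw [← e1]; exact hw.sub h1, ?_⟩
        rw [← e1]
        simpa using h2
  obtain ⟨g, hg, h⟩ := main
  obtain ⟨L', h1, h2⟩ := h w L H
  -- g vanishes on the closure of Ω and w vanishes off Ω, so the remainder gw is zero and w itself
  -- is approximable.
  have e1 : (fun i => g * w i) = 0 := by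
    ext i x
    by_cases hx : x ∈ (Ω : Set E3)
    · simp [hg x (subset_closure hx)]
    · simp [(H.isL2Off_left i).zero x hx]
  rw [e1] at h1 h2
  have e2 := h1.right_ae_zero
  intro ε hε
  obtain ⟨Φ, hΦ⟩ := h2 ε hε
  refine ⟨Φ, fun i => ⟨by simpa using (hΦ i).1, ?_⟩⟩
  refine (eLpNorm_congr_ae ?_).trans_le (hΦ i).2
  filter_upwards [e2 i] with x hx
  simp [hx]

end

/-! ### Zero Cauchy data and extension by zero -/

section
open Filter Topology ContDiff Convolution

variable {Ω : Opens E3} {lam mu : ℝ}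

lemma pderiv_conj {f : E3 → ℂ} (hf : ContDiff ℝ ∞ f) (j : Fin 3) (x : E3) :
    pderiv j (fun y => conj (f y)) x = conj (pderiv j f x) := by
  have h := (Complex.conjCLE.hasFDerivAt (x := f x)).comp x
    (hf.differentiable (by simp) x).hasFDerivAt
  have h' : HasFDerivAt (fun y => conj (f y)) _ x := h
  simp only [pderiv]
  rw [h'.fderiv]
  simp

/-- Integration by parts of a smooth function against a test function. -/
lemma setIntegral_mul_lineDeriv_test {f : E3 → ℂ} (hf : ContDiff ℝ ∞ f) (hs : HasCompactSupport f)
    (φ : 𝓓(Ω, ℂ)) (j : Fin 3) :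
    ∫ x in (Ω : Set E3), f x * (∂_{e j} φ : 𝓓(Ω, ℂ)) x =
      -∫ x in (Ω : Set E3), pderiv j f x * φ x := by
  have hz : ∀ (χ : 𝓓(Ω, ℂ)), ∀ x ∉ (Ω : Set E3), χ x = 0 := fun χ x hx =>
    image_eq_zero_of_notMem_tsupport fun h => hx (χ.tsupport_subset h)
  rw [setIntegral_eq_integral_of_forall_compl_eq_zero (fun x hx => by simp [hz _ x hx]),
    setIntegral_eq_integral_of_forall_compl_eq_zero (fun x hx => by simp [hz _ x hx])]
  have hi : ∀ {a b : E3 → ℂ}, Continuous a → Continuous b → HasCompactSupport a →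
      Integrable (fun x => a x * b x) volume := fun ha hb h =>
    (ha.mul hb).integrable_of_hasCompactSupport h.mul_right
  have hφ : ContDiff ℝ ∞ φ := φ.contDiff
  have h1 := hi (contDiff_pderiv hf j).continuous φ.continuous (hasCompactSupport_pderiv hs j)
  have h2 := hi hf.continuous (contDiff_pderiv hφ j).continuous hs
  have h3 := hi hf.continuous φ.continuous hs
  rw [coe_lineDeriv_test]
  exact integral_mul_fderiv_eq_neg_fderiv_mul_of_integrable h1 h2 h3
    (fun x _ => hf.differentiable (by simp) x) (fun x _ => hφ.differentiable (by simp) x)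

/-- The class in `L²(Ω)` of a smooth compactly supported function on `ℝ³`. -/
def smoothL2 (Ω : Opens E3) (f : E3 → ℂ) (hf : ContDiff ℝ ∞ f) (hs : HasCompactSupport f) : L2 Ω :=
  ((hf.continuous.memLp_of_hasCompactSupport hs).restrict (Ω : Set E3)).toLp f

lemma coeFn_smoothL2 {f : E3 → ℂ} (hf : ContDiff ℝ ∞ f) (hs : HasCompactSupport f) :
    smoothL2 Ω f hf hs =ᵐ[volume.restrict (Ω : Set E3)] f := MemLp.coeFn_toLp _

/-- The element of `H¹(Ω)` given by a smooth compactly supported function on `ℝ³`. -/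
def smoothH1 (Ω : Opens E3) (f : E3 → ℂ) (hf : ContDiff ℝ ∞ f) (hs : HasCompactSupport f) : H1 Ω :=
  ⟨WithLp.toLp 2 (smoothL2 Ω f hf hs, WithLp.toLp 2 fun j =>
    smoothL2 Ω (pderiv j f) (contDiff_pderiv hf j) (hasCompactSupport_pderiv hs j)), by
    intro j φ
    have h1 : ∀ (χ : 𝓓(Ω, ℂ)) (g : E3 → ℂ) (hg : ContDiff ℝ ∞ g) (hgs : HasCompactSupport g),
        ∫ x in (Ω : Set E3), smoothL2 Ω g hg hgs x * χ x = ∫ x in (Ω : Set E3), g x * χ x := by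
      intro χ g hg hgs
      refine integral_congr_ae ?_
      filter_upwards [coeFn_smoothL2 hg hgs] with x hx
      rw [hx]
    refine (h1 _ _ hf hs).trans ((setIntegral_mul_lineDeriv_test hf hs φ j).trans ?_)
    rw [← h1 φ _ (contDiff_pderiv hf j) (hasCompactSupport_pderiv hs j)]
    rfl⟩

lemma fn_smoothH1 {f : E3 → ℂ} (hf : ContDiff ℝ ∞ f) (hs : HasCompactSupport f) :
    H1.fn (smoothH1 Ω f hf hs) = smoothL2 Ω f hf hs := rfl

lemma pd_smoothH1 {f : E3 → ℂ} (hf : ContDiff ℝ ∞ f) (hs : HasCompactSupport f) (j : Fin 3) :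
    H1.pd j (smoothH1 Ω f hf hs) =
      smoothL2 Ω (pderiv j f) (contDiff_pderiv hf j) (hasCompactSupport_pderiv hs j) := rfl

/-- The class in `L²(Ω)` of a test function. -/
def testL2 (φ : 𝓓(Ω, ℂ)) : L2 Ω := smoothL2 Ω φ φ.contDiff φ.hasCompactSupport

lemma coeFn_testL2 (φ : 𝓓(Ω, ℂ)) : testL2 φ =ᵐ[volume.restrict (Ω : Set E3)] φ :=
  coeFn_smoothL2 _ _

/-- A test function as an element of `H¹(Ω)`. -/
def testH1 (φ : 𝓓(Ω, ℂ)) : H1 Ω := smoothH1 Ω φ φ.contDiff φ.hasCompactSupport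

lemma fn_testH1 (φ : 𝓓(Ω, ℂ)) : H1.fn (testH1 φ) = testL2 φ := rfl

lemma pd_testH1 (φ : 𝓓(Ω, ℂ)) (j : Fin 3) : H1.pd j (testH1 φ) = testL2 (∂_{e j} φ) := by
  simp only [testH1, pd_smoothH1, testL2]
  congr 1

lemma isTest_testH1 (φ : 𝓓(Ω, ℂ)) : H1.IsTest (testH1 φ) φ :=
  ⟨coeFn_testL2 φ, fun j => by rw [pd_testH1]; exact coeFn_testL2 _⟩

lemma testH1_mem_H10 (φ : 𝓓(Ω, ℂ)) : testH1 φ ∈ H10 Ω :=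
  Submodule.le_topologicalClosure _ (Submodule.subset_span ⟨φ, isTest_testH1 φ⟩)

lemma inner_testL2 (φ : 𝓓(Ω, ℂ)) (w : L2 Ω) : inner ℂ (testL2 φ) w = pairing w (conjTest φ) :=
  inner_test (testH1 φ) φ (isTest_testH1 φ) w

lemma conjTest_conjTest (φ : 𝓓(Ω, ℂ)) : conjTest (conjTest φ) = φ := by
  ext x
  simp [conjTest_apply]

lemma inner_testL2_lineDeriv (φ : 𝓓(Ω, ℂ)) (v : H1 Ω) (j : Fin 3) :
    inner ℂ (testL2 (∂_{e j} φ)) (H1.fn v) = -inner ℂ (testL2 φ) (H1.pd j v) := by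
  rw [inner_testL2, inner_testL2, ← lineDeriv_conjTest, pairing_lineDeriv]

lemma H1.IsTest.fn_eq {u : H1 Ω} {φ : 𝓓(Ω, ℂ)} (h : H1.IsTest u φ) : H1.fn u = testL2 φ :=
  Lp.ext (h.1.trans (coeFn_testL2 φ).symm)

lemma H1.IsTest.pd_eq {u : H1 Ω} {φ : 𝓓(Ω, ℂ)} (h : H1.IsTest u φ) (j : Fin 3) :
    H1.pd j u = testL2 (∂_{e j} φ) :=
  Lp.ext ((h.2 j).trans (coeFn_testL2 _).symm)

/-- A continuous linear functional vanishing at test functions vanishes on `H¹₀(Ω)`. -/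
lemma H10_le_ker (ℓ : H1 Ω →L[ℂ] ℂ) (h : ∀ u φ, H1.IsTest u φ → ℓ u = 0) {u : H1 Ω}
    (hu : u ∈ H10 Ω) : ℓ u = 0 := by
  have : H10 Ω ≤ ℓ.ker := by
    refine Submodule.topologicalClosure_minimal _ (Submodule.span_le.2 ?_) ℓ.isClosed_ker
    rintro w ⟨φ, hw⟩
    exact h w φ hw
  exact this hu

/-- No boundary term arises as soon as one of the two functions is in H¹₀: the identity holds for
test functions and is continuous in u. -/
lemma inner_pd_fn_of_mem_H10 {u : H1 Ω} (hu : u ∈ H10 Ω) (v : H1 Ω) (j : Fin 3) :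
    inner ℂ (H1.pd j v) (H1.fn u) = -inner ℂ (H1.fn v) (H1.pd j u) := by
  have := H10_le_ker ((innerSL ℂ (H1.pd j v)).comp H1.fn + (innerSL ℂ (H1.fn v)).comp (H1.pd j))
    (fun w φ hw => ?_) hu
  · simpa [add_eq_zero_iff_eq_neg] using this
  · have h1 := inner_testL2_lineDeriv φ v j
    rw [← hw.fn_eq, ← hw.pd_eq] at h1
    have h2 := congrArg conj h1
    rw [map_neg, inner_conj_symm, inner_conj_symm] at h2
    simp [h2]

/-- For a test function both sides equal minus the pairing of v with its mixed second derivative.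
This symmetry is what Korn's inequality rests on. -/
lemma inner_pd_pd_of_mem_H10 {u : H1 Ω} (hu : u ∈ H10 Ω) (v : H1 Ω) (i j : Fin 3) :
    inner ℂ (H1.pd i v) (H1.pd j u) = inner ℂ (H1.pd j v) (H1.pd i u) := by
  have := H10_le_ker ((innerSL ℂ (H1.pd i v)).comp (H1.pd j) -
    (innerSL ℂ (H1.pd j v)).comp (H1.pd i)) (fun w φ hw => ?_) hu
  · simpa [sub_eq_zero] using this
  · have h1 := inner_testL2_lineDeriv (∂_{e j} φ) v i
    have h2 := inner_testL2_lineDeriv (∂_{e i} φ) v j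
    rw [lineDeriv_comm_test, h2, neg_inj, ← hw.pd_eq, ← hw.pd_eq] at h1
    have h3 := congrArg conj h1
    rw [inner_conj_symm, inner_conj_symm] at h3
    simp [h3]

/-- Extension by zero. -/
def zeroExt (f : L2 Ω) : E3 → ℂ := (Ω : Set E3).indicator f

lemma isL2Off_zeroExt (f : L2 Ω) : IsL2Off Ω (zeroExt f) := by
  refine ⟨(Lp.stronglyMeasurable f).indicator Ω.isOpen.measurableSet, ?_, fun x hx => ?_⟩
  · exact (memLp_indicator_iff_restrict Ω.isOpen.measurableSet).2 (Lp.memLp f)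
  · exact Set.indicator_of_notMem hx _

lemma zeroExt_ae_eq (f : L2 Ω) : zeroExt f =ᵐ[volume.restrict (Ω : Set E3)] f :=
  indicator_ae_eq_restrict Ω.isOpen.measurableSet

/-- The Hermitian product conjugates its first argument, hence the conjugated test function. -/
lemma integral_mul_eq_inner {F φ : E3 → ℂ} {f : L2 Ω} (hF : ∀ x ∉ (Ω : Set E3), F x = 0)
    (h : F =ᵐ[volume.restrict (Ω : Set E3)] f)
    (hφ : ContDiff ℝ ∞ (fun x => conj (φ x))) (hs : HasCompactSupport (fun x => conj (φ x))) :
    ∫ x, F x * φ x = inner ℂ (smoothL2 Ω (fun x => conj (φ x)) hφ hs) f := by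
  rw [L2.inner_def, ← setIntegral_eq_integral_of_forall_compl_eq_zero (s := (Ω : Set E3))
    (fun x hx => by simp [hF x hx])]
  refine integral_congr_ae ?_
  filter_upwards [h, coeFn_smoothL2 (Ω := Ω) hφ hs] with x h1 h2
  simp [h1, h2]

/-- A test function on ℝ³ need not vanish on ∂Ω, but its restriction is in H¹(Ω), and integrating by
parts against u in H¹₀ has no boundary term. -/
lemma hasWeakDiv_of_mem_H10 {u : H1 Ω} (hu : u ∈ H10 Ω) (j : Fin 3) :
    HasWeakDiv Ω (Pi.single j (zeroExt (H1.fn u))) (zeroExt (H1.pd j u)) := by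
  refine ⟨fun k => ?_, isL2Off_zeroExt _, fun φ hφ hs => ?_⟩
  · by_cases hk : k = j
    · subst hk; simpa using isL2Off_zeroExt _
    · simpa [hk] using IsL2Off.zero'
  · rw [Finset.sum_eq_single j (fun k _ hk => by simp [hk]) (by simp), Pi.single_eq_same]
    have hφc : ContDiff ℝ ∞ (fun x => conj (φ x)) := Complex.conjCLE.contDiff.comp hφ
    have hsc : HasCompactSupport (fun x => conj (φ x)) := hs.comp_left (g := conj) (map_zero _)
    have e1 : pderiv j (fun x => conj (φ x)) = fun x => conj (pderiv j φ x) :=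
      funext (pderiv_conj hφ j)
    have hφd := contDiff_pderiv hφc j
    have hsd := hasCompactSupport_pderiv hsc j
    have key := inner_pd_fn_of_mem_H10 hu (smoothH1 Ω _ hφc hsc) j
    rw [integral_mul_eq_inner (isL2Off_zeroExt _).zero (zeroExt_ae_eq _) hφc hsc,
      integral_mul_eq_inner (isL2Off_zeroExt _).zero (zeroExt_ae_eq _) (e1 ▸ hφd) (e1 ▸ hsd)]
    rw [pd_smoothH1, fn_smoothH1] at key
    rw [← key]
    congr 2
    exact e1.symm

lemma stressOf_zeroExt (u : H1v Ω) (i j : Fin 3) :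
    stressOf lam mu (fun i j => zeroExt (H1.pd j (u i))) i j =ᵐ[volume.restrict (Ω : Set E3)]
      stress lam mu u i j := by
  have hadd : ∀ {f g : L2 Ω} {F G : E3 → ℂ}, F =ᵐ[volume.restrict (Ω : Set E3)] f →
      G =ᵐ[volume.restrict (Ω : Set E3)] g → F + G =ᵐ[volume.restrict (Ω : Set E3)] (f + g : L2 Ω) :=
    fun h1 h2 => (h1.add h2).trans (Lp.coeFn_add _ _).symm
  have hsmul : ∀ {f : L2 Ω} {F : E3 → ℂ} (c : ℂ), F =ᵐ[volume.restrict (Ω : Set E3)] f →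
      c • F =ᵐ[volume.restrict (Ω : Set E3)] (c • f : L2 Ω) :=
    fun c h1 => (h1.const_smul c).trans (Lp.coeFn_smul _ _).symm
  have h1 : ∀ i j, zeroExt (H1.pd j (u i)) =ᵐ[volume.restrict (Ω : Set E3)] H1.pd j (u i) :=
    fun i j => zeroExt_ae_eq _
  rw [stressOf_apply, stress]
  refine hadd ?_ (hsmul _ (hadd (h1 _ _) (h1 _ _)))
  split_ifs
  · simp only [Fin.sum_univ_three]
    exact hsmul _ (hadd (hadd (h1 _ _) (h1 _ _)) (h1 _ _))
  · exact (Lp.coeFn_zero _ _ _).symm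

lemma isL2Off_stressOf {S : Set E3} {D : Fin 3 → Fin 3 → E3 → ℂ} (h : ∀ i j, IsL2Off S (D i j))
    (i j : Fin 3) : IsL2Off S (stressOf lam mu D i j) := by
  rw [stressOf_apply]
  refine IsL2Off.add ?_ (((h i j).add (h j i)).smul _)
  split_ifs
  · simp only [Fin.sum_univ_three]
    exact (((h _ _).add (h _ _)).add (h _ _)).smul _
  · exact .zero'

/-- Extension by zero of a field with vanishing Cauchy data. -/
lemma extField_zeroExt (u : HLame Ω lam mu) (h0 : ∀ i, HLame.toH1v u i ∈ H10 Ω)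
    (h1 : ∀ i v, greenForm u i v = 0) :
    ExtField lam mu Ω (fun i => zeroExt (H1.fn (HLame.toH1v u i)))
      (fun i => zeroExt (HLame.lame u i)) := by
  refine ⟨fun i j => zeroExt (H1.pd j (HLame.toH1v u i)), fun i j => hasWeakDiv_of_mem_H10 (h0 i) j,
    fun i => ?_⟩
  have hS : ∀ j, IsL2Off (Ω : Set E3)
      (stressOf lam mu (fun i j => zeroExt (H1.pd j (HLame.toH1v u i))) i j) :=
    isL2Off_stressOf (fun _ _ => isL2Off_zeroExt _) i
  refine ⟨hS, isL2Off_zeroExt _, fun φ hφ hs => ?_⟩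
  have hφc : ContDiff ℝ ∞ (fun x => conj (φ x)) := Complex.conjCLE.contDiff.comp hφ
  have hsc : HasCompactSupport (fun x => conj (φ x)) := hs.comp_left (g := conj) (map_zero _)
  -- Vanishing traction means that Green's functional also kills restrictions of functions that do
  -- not vanish on ∂Ω; this is the weak divergence equation on ℝ³.
  have key := h1 i (smoothH1 Ω _ hφc hsc)
  simp only [greenForm, add_apply, sum_apply, ContinuousLinearMap.comp_apply,
    innerSLFlip_apply_apply] at key
  rw [integral_mul_eq_inner (isL2Off_zeroExt _).zero (zeroExt_ae_eq _) hφc hsc]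
  rw [← fn_smoothH1, ← add_eq_zero_iff_eq_neg, ← key]
  congr 1
  refine Finset.sum_congr rfl fun j _ => ?_
  have e1 : pderiv j (fun x => conj (φ x)) = fun x => conj (pderiv j φ x) :=
    funext (pderiv_conj hφ j)
  have hφd := contDiff_pderiv hφc j
  have hsd := hasCompactSupport_pderiv hsc j
  rw [integral_mul_eq_inner (hS j).zero (stressOf_zeroExt _ i j) (e1 ▸ hφd) (e1 ▸ hsd), pd_smoothH1]
  congr 2
  exact e1.symm

/-- A vector test field as an element of `(L²(Ω))³`. -/
def testField (Φ : Fin 3 → 𝓓(Ω, ℂ)) : L2v Ω := WithLp.toLp 2 fun i => testL2 (Φ i)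

lemma norm_testL2_sub_le (φ : 𝓓(Ω, ℂ)) (f : L2 Ω) :
    edist (testL2 φ) f ≤ eLpNorm (⇑φ - zeroExt f) 2 volume := by
  rw [Lp.edist_def]
  refine (eLpNorm_congr_ae ?_).trans_le (eLpNorm_mono_measure _ Measure.restrict_le_self)
  exact (coeFn_testL2 φ).sub (zeroExt_ae_eq f).symm

/-- Test fields are dense, in the graph norm, among the fields with vanishing Cauchy data. -/
theorem mem_closure_testGraph (hbdd : Bornology.IsBounded (Ω : Set E3)) (hΩ : HasC2Boundary Ω)
    (u : HLame Ω lam mu) (h0 : ∀ i, HLame.toH1v u i ∈ H10 Ω) (h1 : ∀ i v, greenForm u i v = 0) :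
    (H1v.fn (HLame.toH1v u), HLame.lame u) ∈
      closure (Set.range fun Φ : Fin 3 → 𝓓(Ω, ℂ) =>
        (testField Φ, testField (lameTest lam mu Φ))) := by
  have H := (extField_zeroExt u h0 h1).testApprox hbdd hΩ
  have hpos : ∀ n : ℕ, (0 : ℝ≥0∞) < ((n : ℝ≥0∞) + 1)⁻¹ := fun n =>
    ENNReal.inv_pos.2 (by finiteness)
  choose Φ hΦ using fun n : ℕ => H _ (hpos n)
  have htend : Tendsto (fun n : ℕ => ((n : ℝ≥0∞) + 1)⁻¹) atTop (𝓝 0) := by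
    have := (ENNReal.tendsto_inv_nat_nhds_zero).comp (tendsto_add_atTop_nat 1)
    refine this.congr fun n => ?_
    simp
  refine mem_closure_of_tendsto (f := fun n => (testField (Φ n), testField (lameTest lam mu (Φ n))))
    (b := atTop) ?_ (.of_forall fun n => ⟨Φ n, rfl⟩)
  have hL : ∀ {F : ℕ → Fin 3 → L2 Ω} {f : Fin 3 → L2 Ω},
      (∀ n i, edist (F n i) (f i) ≤ ((n : ℝ≥0∞) + 1)⁻¹) →
      Tendsto (fun n => (WithLp.toLp 2 (F n) : L2v Ω)) atTop (𝓝 (WithLp.toLp 2 f)) := by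
    intro F f h
    refine ((PiLp.continuous_toLp 2 _).tendsto f).comp (tendsto_pi_nhds.2 fun i => ?_)
    rw [tendsto_iff_edist_tendsto_0]
    exact tendsto_of_tendsto_of_tendsto_of_le_of_le tendsto_const_nhds htend
      (fun _ => zero_le) (fun n => h n i)
  refine Tendsto.prodMk_nhds ?_ ?_
  · exact hL (f := fun i => H1.fn (HLame.toH1v u i))
      fun n i => (norm_testL2_sub_le _ _).trans (hΦ n i).1
  · exact hL (f := fun i => HLame.lame u i)
      fun n i => (norm_testL2_sub_le _ _).trans (hΦ n i).2

end

/-! ### Hilbert space structure of ℋ(Ω) and its subspace with zero Cauchy data -/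

section
open Filter Topology ContDiff Convolution

variable {Ω : Opens E3} {lam mu : ℝ}

lemma lameTest_conjTest (Φ : Fin 3 → 𝓓(Ω, ℂ)) (i : Fin 3) :
    lameTest lam mu (fun k => conjTest (Φ k)) i = conjTest (lameTest lam mu Φ i) := by
  simp only [lameTest, lineDeriv_conjTest]
  ext x
  simp [conjTest_apply, Fin.sum_univ_three]

/-- Stated with inner products, the condition is visibly closed in L²; this gives completeness of
H¹(Ω). -/
lemma isWeakPartial_iff (j : Fin 3) (u v : L2 Ω) :
    IsWeakPartial j u v ↔
      ∀ φ : 𝓓(Ω, ℂ), inner ℂ (testL2 (∂_{e j} φ)) u = -inner ℂ (testL2 φ) v := by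
  constructor
  · intro h φ
    rw [inner_testL2, inner_testL2, ← lineDeriv_conjTest]
    exact h _
  · intro h φ
    have := h (conjTest φ)
    rw [inner_testL2, inner_testL2, ← lineDeriv_conjTest, conjTest_conjTest] at this
    exact this

lemma inner_testField (Φ : Fin 3 → 𝓓(Ω, ℂ)) (u : L2v Ω) :
    inner ℂ (testField Φ) u = ∑ i, pairing (u i) (conjTest (Φ i)) := by
  simp only [PiLp.inner_apply, testField, inner_testL2]

/-- Conjugating the test fields turns the distributional equation into Hilbert space identities,
used both for completeness of ℋ(Ω) and for the variational argument. -/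
lemma isWeakLame_iff {u g : L2v Ω} {g' : Fin 3 → E3 → ℂ}
    (hg : ∀ i, g' i =ᵐ[volume.restrict (Ω : Set E3)] g i) :
    IsWeakLame lam mu u g' ↔ ∀ Φ : Fin 3 → 𝓓(Ω, ℂ),
      inner ℂ (testField (lameTest lam mu Φ)) u = inner ℂ (testField Φ) g := by
  have h1 : ∀ Φ : Fin 3 → 𝓓(Ω, ℂ), ∑ i, ∫ x in (Ω : Set E3), g' i x * Φ i x =
      ∑ i, pairing (g i) (Φ i) := fun Φ => Finset.sum_congr rfl fun i _ => by
    refine integral_congr_ae ?_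
    filter_upwards [hg i] with x hx
    rw [hx]
  constructor
  · intro h Φ
    have := h fun k => conjTest (Φ k)
    rw [h1] at this
    rw [inner_testField, inner_testField, ← this]
    simp only [lameTest_conjTest]
    rfl
  · intro h Φ
    have := h fun k => conjTest (Φ k)
    rw [inner_testField, inner_testField] at this
    simp only [lameTest_conjTest, conjTest_conjTest] at this
    rw [h1, ← this]
    rfl

lemma isClosed_H1 : IsClosed (H1 Ω : Set (WithLp 2 (L2 Ω × L2v Ω))) := by
  have : (H1 Ω : Set (WithLp 2 (L2 Ω × L2v Ω))) = ⋂ (j : Fin 3) (φ : 𝓓(Ω, ℂ)),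
      {p | inner ℂ (testL2 (∂_{e j} φ)) p.fst = -inner ℂ (testL2 φ) (p.snd j)} := by
    ext p
    simp only [Set.mem_iInter, Set.mem_ofPred_eq, ← isWeakPartial_iff]
    rfl
  rw [this]
  refine isClosed_iInter fun j => isClosed_iInter fun φ => isClosed_eq ?_ ?_
  · exact continuous_const.inner (WithLp.fstL 2 ℂ (L2 Ω) (L2v Ω)).continuous
  · exact (continuous_const.inner ((PiLp.proj 2 (𝕜 := ℂ) (fun _ : Fin 3 => L2 Ω) j).comp
      (WithLp.sndL 2 ℂ (L2 Ω) (L2v Ω))).continuous).neg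

instance : CompleteSpace (H1 Ω) := isClosed_H1.completeSpace_coe

/-- The `L²` field underlying an `H¹` field, as a continuous linear map. -/
def H1v.fnL : H1v Ω →L[ℂ] L2v Ω where
  toFun := H1v.fn
  map_add' u v := by ext1 i; simp [H1v.fn]
  map_smul' c u := by ext1 i; simp [H1v.fn]
  cont := (PiLp.continuous_toLp 2 _).comp (continuous_pi fun i =>
    H1.fn.continuous.comp (PiLp.proj 2 (𝕜 := ℂ) (fun _ : Fin 3 => H1 Ω) i).continuous)

lemma isClosed_HLame : IsClosed (HLame Ω lam mu : Set (WithLp 2 (H1v Ω × L2v Ω))) := by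
  have : (HLame Ω lam mu : Set (WithLp 2 (H1v Ω × L2v Ω))) = ⋂ (Φ : Fin 3 → 𝓓(Ω, ℂ)),
      {p | inner ℂ (testField (lameTest lam mu Φ)) (H1v.fnL p.fst) =
        inner ℂ (testField Φ) p.snd} := by
    ext p
    simp only [Set.mem_iInter, Set.mem_ofPred_eq]
    exact isWeakLame_iff (fun i => ae_eq_rfl)
  rw [this]
  refine isClosed_iInter fun Φ => isClosed_eq ?_ ?_
  · exact continuous_const.inner (H1v.fnL.comp (WithLp.fstL 2 ℂ (H1v Ω) (L2v Ω))).continuous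
  · exact continuous_const.inner (WithLp.sndL 2 ℂ (H1v Ω) (L2v Ω)).continuous

instance instInnerH1 : InnerProductSpace ℂ (H1 Ω) := inferInstance
instance instInnerH1v : InnerProductSpace ℂ (H1v Ω) := inferInstance
instance instInnerProd : InnerProductSpace ℂ (WithLp 2 (H1v Ω × L2v Ω)) :=
  WithLp.instProdInnerProductSpace
instance instInnerHLame : InnerProductSpace ℂ (HLame Ω lam mu) := inferInstance
instance : CompleteSpace (HLame Ω lam mu) := isClosed_HLame.completeSpace_coe

namespace HLame

/-- `u ↦ u_i` as a map into `H¹(Ω)`. -/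
def compL (i : Fin 3) : HLame Ω lam mu →L[ℂ] H1 Ω :=
  (PiLp.proj 2 (𝕜 := ℂ) (fun _ : Fin 3 => H1 Ω) i).comp
    ((WithLp.fstL 2 ℂ (H1v Ω) (L2v Ω)).comp (HLame Ω lam mu).subtypeL)

/-- `u ↦ u` as a map into `(L²(Ω))³`. -/
def fnL : HLame Ω lam mu →L[ℂ] L2v Ω :=
  H1v.fnL.comp ((WithLp.fstL 2 ℂ (H1v Ω) (L2v Ω)).comp (HLame Ω lam mu).subtypeL)

/-- `u ↦ Δ* u` as a continuous linear map. -/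
def lameL : HLame Ω lam mu →L[ℂ] L2v Ω :=
  (WithLp.sndL 2 ℂ (H1v Ω) (L2v Ω)).comp (HLame Ω lam mu).subtypeL

/-- `u ↦ Δ* u_i` as a continuous linear map. -/
def lameCompL (i : Fin 3) : HLame Ω lam mu →L[ℂ] L2 Ω :=
  (PiLp.proj 2 (𝕜 := ℂ) (fun _ : Fin 3 => L2 Ω) i).comp lameL

/-- `u ↦ σ(u)_{ij}` as a continuous linear map. -/
def stressL (i j : Fin 3) : HLame Ω lam mu →L[ℂ] L2 Ω :=
  (if i = j then (lam : ℂ) • ∑ k, (H1.pd k).comp (compL k) else 0) +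
    (mu : ℂ) • ((H1.pd j).comp (compL i) + (H1.pd i).comp (compL j))

lemma ite_smul_sum_add_smul_apply {M N : Type*} [NormedAddCommGroup M] [NormedSpace ℂ M]
    [NormedAddCommGroup N] [NormedSpace ℂ N] (p : Prop) [Decidable p] (c d : ℂ)
    (A : Fin 3 → M →L[ℂ] N) (B C : M →L[ℂ] N) (u : M) :
    ((if p then c • ∑ k, A k else 0) + d • (B + C)) u =
      (if p then c • ∑ k, A k u else 0) + d • (B u + C u) := by
  split_ifs <;> simp

lemma stressL_apply (i j : Fin 3) (u : HLame Ω lam mu) :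
    stressL i j u = stress lam mu (toH1v u) i j := by
  exact ite_smul_sum_add_smul_apply _ _ _ _ _ _ u

/-- `u ↦ greenForm u i v` as a continuous linear functional. -/
def greenL (i : Fin 3) (v : H1 Ω) : HLame Ω lam mu →L[ℂ] ℂ :=
  (∑ j, (innerSL ℂ (H1.pd j v)).comp (stressL i j)) + (innerSL ℂ (H1.fn v)).comp (lameCompL i)

lemma greenL_apply (i : Fin 3) (v : H1 Ω) (u : HLame Ω lam mu) :
    greenL i v u = greenForm u i v := by
  simp only [greenL, greenForm, add_apply, sum_apply, ContinuousLinearMap.comp_apply,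
    innerSLFlip_apply_apply, innerSL_apply_apply, stressL_apply]
  rfl

/-- The fields in `ℋ(Ω)` with vanishing Cauchy data. -/
def zeroData (Ω : Opens E3) (lam mu : ℝ) : Submodule ℂ (HLame Ω lam mu) :=
  (⨅ i, (H10 Ω).comap (compL i).toLinearMap) ⊓ ⨅ (i : Fin 3) (v : H1 Ω), (greenL i v).ker

lemma mem_zeroData {u : HLame Ω lam mu} :
    u ∈ zeroData Ω lam mu ↔ (∀ i, toH1v u i ∈ H10 Ω) ∧ ∀ i v, greenForm u i v = 0 := by
  simp only [zeroData, Submodule.mem_inf, Submodule.mem_iInf, Submodule.mem_comap,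
    LinearMap.mem_ker, ContinuousLinearMap.coe_coe, greenL_apply]
  rfl

lemma isClosed_zeroData : IsClosed (zeroData Ω lam mu : Set (HLame Ω lam mu)) := by
  simp only [zeroData, Submodule.coe_inf, Submodule.coe_iInf]
  refine (isClosed_iInter fun i => ?_).inter
    (isClosed_iInter fun i => isClosed_iInter fun v => (greenL i v).isClosed_ker)
  exact (Submodule.isClosed_topologicalClosure _).preimage (compL i).continuous

/-- Prescribing the Cauchy data of u₀ is the same as moving in the affine space u₀ + X. -/
lemma sub_mem_zeroData_iff (u v : HLame Ω lam mu) :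
    u - v ∈ zeroData Ω lam mu ↔
      trace0 (toH1v u) = trace0 (toH1v v) ∧ trace1 u = trace1 v := by
  have h1 : ∀ i w, greenForm (u - v) i w = greenForm u i w - greenForm v i w := by
    intro i w
    rw [← greenL_apply, map_sub, greenL_apply, greenL_apply]
  simp only [mem_zeroData, h1, sub_eq_zero, funext_iff]
  refine and_congr (forall_congr' fun i => ?_) (forall_congr' fun i => ?_)
  · exact (Submodule.Quotient.eq (H10 Ω)).symm
  · constructor
    · intro h
      ext x
      obtain ⟨w, rfl⟩ := Submodule.Quotient.mk_surjective _ x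
      exact h w
    · intro h w
      exact congrArg (fun ℓ : HMinusHalf Ω => ℓ ((H10 Ω).mkQ w)) h

end HLame

end

/-! ### Symmetry of Δ*, Korn and Poincaré inequalities -/

section
open Filter Topology ContDiff Convolution

variable {Ω : Opens E3} {lam mu : ℝ}

lemma testL2_add (φ χ : 𝓓(Ω, ℂ)) : testL2 (φ + χ) = testL2 φ + testL2 χ := rfl

lemma testL2_smul (c : ℝ) (φ : 𝓓(Ω, ℂ)) : testL2 (c • φ) = (c : ℂ) • testL2 φ := by
  refine Lp.ext ((coeFn_testL2 _).trans (EventuallyEq.trans ?_ (Lp.coeFn_smul _ _).symm))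
  filter_upwards [coeFn_testL2 φ] with x hx
  simp [hx]

lemma testL2_sum (φ : Fin 3 → 𝓓(Ω, ℂ)) : testL2 (∑ k, φ k) = ∑ k, testL2 (φ k) := by
  simp only [Fin.sum_univ_three, testL2_add]

lemma inner_testL2_lineDeriv_testL2 (φ χ : 𝓓(Ω, ℂ)) (j : Fin 3) :
    inner ℂ (testL2 (∂_{e j} φ)) (testL2 χ) = -inner ℂ (testL2 φ) (testL2 (∂_{e j} χ)) := by
  have := inner_testL2_lineDeriv φ (testH1 χ) j
  rwa [fn_testH1, pd_testH1] at this

lemma inner_testField_lameTest (Ψ Φ : Fin 3 → 𝓓(Ω, ℂ)) :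
    inner ℂ (testField (lameTest lam mu Ψ)) (testField Φ) =
      inner ℂ (testField Ψ) (testField (lameTest lam mu Φ)) := by
  have h2 : ∀ (φ χ : 𝓓(Ω, ℂ)) (i j : Fin 3),
      inner ℂ (testL2 (∂_{e i} (∂_{e j} φ))) (testL2 χ) =
        inner ℂ (testL2 φ) (testL2 (∂_{e j} (∂_{e i} χ))) := by
    intro φ χ i j
    rw [inner_testL2_lineDeriv_testL2, inner_testL2_lineDeriv_testL2, neg_neg]
  simp only [PiLp.inner_apply, testField, lameTest, testL2_add, testL2_smul, testL2_sum,
    inner_add_left, inner_add_right, inner_smul_left, inner_smul_right, sum_inner, inner_sum,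
    Complex.conj_ofReal, h2, Finset.sum_add_distrib, ← Finset.mul_sum]
  congr 2
  rw [Finset.sum_comm]

/-- A test field as an element of `ℋ(Ω)`. -/
def testHLame (lam mu : ℝ) (Φ : Fin 3 → 𝓓(Ω, ℂ)) : HLame Ω lam mu :=
  ⟨WithLp.toLp 2 (WithLp.toLp 2 fun i => testH1 (Φ i), testField (lameTest lam mu Φ)),
    (isWeakLame_iff (u := testField Φ) (fun _ => ae_eq_rfl)).2
      fun Ψ => inner_testField_lameTest Ψ Φ⟩

lemma fnL_testHLame (Φ : Fin 3 → 𝓓(Ω, ℂ)) : HLame.fnL (testHLame lam mu Φ) = testField Φ := rfl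

lemma lameL_testHLame (Φ : Fin 3 → 𝓓(Ω, ℂ)) :
    HLame.lameL (testHLame lam mu Φ) = testField (lameTest lam mu Φ) := rfl

/-- Green's functional vanishes because Δ*Φ is the divergence of the stress of Φ and derivatives of
test functions may be moved onto any v in H¹(Ω). -/
lemma testHLame_mem_zeroData (Φ : Fin 3 → 𝓓(Ω, ℂ)) :
    testHLame lam mu Φ ∈ HLame.zeroData Ω lam mu := by
  refine HLame.mem_zeroData.2 ⟨fun i => testH1_mem_H10 _, fun i v => ?_⟩
  have hs : ∀ j, stress lam mu (HLame.toH1v (testHLame lam mu Φ)) i j =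
      testL2 ((if i = j then lam • ∑ k, ∂_{e k} (Φ k) else 0) +
        mu • (∂_{e j} (Φ i) + ∂_{e i} (Φ j))) := by
    intro j
    have h : ∀ i j, H1.pd j (HLame.toH1v (testHLame lam mu Φ) i) = testL2 (∂_{e j} (Φ i)) :=
      fun i j => pd_testH1 _ _
    rw [testL2_add, testL2_smul, testL2_add, stress, h, h]
    congr 1
    split_ifs
    · rw [testL2_smul, testL2_sum]
      simp only [h]
    · rfl
  have hp : ∀ (φ : 𝓓(Ω, ℂ)) (j : Fin 3), inner ℂ (H1.pd j v) (testL2 φ) =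
      -inner ℂ (H1.fn v) (testL2 (∂_{e j} φ)) := by
    intro φ j
    have h1 := congrArg conj (inner_testL2_lineDeriv φ v j)
    rw [map_neg, inner_conj_symm, inner_conj_symm] at h1
    rw [h1, neg_neg]
  have hl : HLame.lame (testHLame lam mu Φ) i = testL2 (lameTest lam mu Φ i) := rfl
  simp only [greenForm, add_apply, sum_apply, ContinuousLinearMap.comp_apply,
    innerSLFlip_apply_apply, hs, hp, hl]
  rw [lameTest_eq_sum_lineDeriv, testL2_sum, inner_sum, Finset.sum_neg_distrib, neg_add_cancel]

/-- Pointwise form of Korn's inequality for matrices with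
`⟪D i j, D j i⟫ = ⟪D i i, D j j⟫`. -/
lemma korn_matrix {N : Type*} [NormedAddCommGroup N] [InnerProductSpace ℂ N]
    (hmu : 0 < mu) (hlam : 0 < 3 * lam + 2 * mu)
    (D : Fin 3 → Fin 3 → N) (hD : ∀ i j, inner ℂ (D i j) (D j i) = inner ℂ (D i i) (D j j)) :
    min mu (3 * lam + 2 * mu) * ∑ i, ∑ j, ‖D i j‖ ^ 2 ≤
      (∑ i, ∑ j, inner ℂ (D i j) ((if i = j then (lam : ℂ) • ∑ k, D k k else 0) +
        (mu : ℂ) • (D i j + D j i))).re := by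
  set S : ℝ := ∑ i, ∑ j, ‖D i j‖ ^ 2 with hS
  set d : N := ∑ k, D k k with hd
  have hdd : inner ℂ d d = ∑ i, ∑ j, inner ℂ (D i j) (D j i) := by
    simp only [hD, hd, sum_inner, inner_sum]
    rw [Finset.sum_comm]
  have e1 : (∑ i, ∑ j, inner ℂ (D i j) ((if i = j then (lam : ℂ) • d else 0) +
        (mu : ℂ) • (D i j + D j i))) =
      lam * inner ℂ d d + mu * (∑ i, ∑ j, inner ℂ (D i j) (D i j)) + mu * inner ℂ d d := by
    have : ∀ i j, inner ℂ (D i j) (if i = j then (lam : ℂ) • d else 0) =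
        if i = j then lam * inner ℂ (D i i) d else 0 := by
      intro i j
      split_ifs with h
      · subst h; rw [inner_smul_right]
      · exact inner_zero_right _
    simp only [inner_add_right, inner_smul_right, this, Finset.sum_add_distrib,
      Finset.sum_ite_eq, Finset.mem_univ, if_true, ← Finset.mul_sum, mul_add, ← hdd]
    rw [← sum_inner, ← hd]
    ring
  have e2 : (∑ i, ∑ j, inner ℂ (D i j) (D i j)) = (S : ℂ) := by
    rw [hS]
    push_cast
    simp only [inner_self_eq_norm_sq_to_K]
    rfl
  have e3 : inner ℂ d d = ((‖d‖ ^ 2 : ℝ) : ℂ) := by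
    rw [inner_self_eq_norm_sq_to_K]; simp
  have hq : ‖d‖ ^ 2 ≤ S := by
    have h1 : ‖d‖ ^ 2 = ∑ i, ∑ j, (inner ℂ (D i j) (D j i)).re := by
      have := congrArg Complex.re hdd
      rw [e3, Complex.ofReal_re] at this
      rw [this]
      simp only [Complex.re_sum]
    -- Cauchy–Schwarz on the symmetric form ‖d‖² = ∑ Re⟪D i j, D j i⟫ of the squared divergence
    -- gives ‖d‖² ≤ S.
    have h2 : ∀ i j, (inner ℂ (D i j) (D j i)).re ≤ (‖D i j‖ ^ 2 + ‖D j i‖ ^ 2) / 2 := by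
      intro i j
      have := re_inner_le_norm (𝕜 := ℂ) (D i j) (D j i)
      have h3 := two_mul_le_add_sq ‖D i j‖ ‖D j i‖
      simp only [RCLike.re_to_complex] at this
      linarith
    rw [h1]
    calc _ ≤ ∑ i, ∑ j, (‖D i j‖ ^ 2 + ‖D j i‖ ^ 2) / 2 :=
          Finset.sum_le_sum fun i _ => Finset.sum_le_sum fun j _ => h2 i j
      _ = S := by
          rw [hS]
          simp only [Fin.sum_univ_three]
          ring
  have hS0 : 0 ≤ S := Finset.sum_nonneg fun i _ => Finset.sum_nonneg fun j _ => sq_nonneg _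
  have hd0 : 0 ≤ ‖d‖ ^ 2 := sq_nonneg _
  rw [e1, e2, e3]
  have e4 : ((lam : ℂ) * ((‖d‖ ^ 2 : ℝ) : ℂ) + mu * (S : ℂ) + mu * ((‖d‖ ^ 2 : ℝ) : ℂ)).re =
      lam * ‖d‖ ^ 2 + mu * S + mu * ‖d‖ ^ 2 := by
    rw [← Complex.ofReal_mul, ← Complex.ofReal_mul, ← Complex.ofReal_mul, ← Complex.ofReal_add,
      ← Complex.ofReal_add, Complex.ofReal_re]
  rw [e4]
  have hm1 := min_le_left mu (3 * lam + 2 * mu)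
  have hm2 := min_le_right mu (3 * lam + 2 * mu)
  -- The form equals μS + (λ + μ)‖d‖². If λ + μ ≥ 0, drop the last term; otherwise ‖d‖² ≤ S bounds
  -- it below by (λ + 2μ)S. The second case is in fact vacuous, since 3λ + 2μ > 0 and μ > 0 force λ
  -- + μ > 0.
  rcases le_or_gt 0 (lam + mu) with h | h
  · nlinarith [mul_le_mul_of_nonneg_right hm1 hS0, mul_nonneg h hd0]
  · have h5 : min mu (3 * lam + 2 * mu) ≤ lam + 2 * mu := by linarith
    nlinarith [mul_le_mul_of_nonneg_right h5 hS0, mul_nonneg (sub_nonneg.2 hq) (by linarith :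
      0 ≤ -(lam + mu))]

/-- Korn's inequality on `H¹₀(Ω)³`. -/
lemma korn (hmu : 0 < mu) (hlam : 0 < 3 * lam + 2 * mu) (u : H1v Ω) (hu : ∀ i, u i ∈ H10 Ω) :
    min mu (3 * lam + 2 * mu) * ∑ i, ∑ j, ‖H1.pd j (u i)‖ ^ 2 ≤
      (∑ i, ∑ j, inner ℂ (H1.pd j (u i)) (stress lam mu u i j)).re :=
  korn_matrix hmu hlam (fun i j => H1.pd j (u i)) fun i j =>
    (inner_pd_pd_of_mem_H10 (hu j) (u i) i j).symm

lemma dirichletEigenvalue_mul_le {u : H1 Ω} (hu : u ∈ H10 Ω) :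
    dirichletEigenvalue Ω * ‖H1.fn u‖ ^ 2 ≤ ∑ j, ‖H1.pd j u‖ ^ 2 := by
  have h0 : 0 ≤ ∑ j, ‖H1.pd j u‖ ^ 2 := Finset.sum_nonneg fun j _ => sq_nonneg _
  by_cases h : H1.fn u = 0
  · simpa [h] using h0
  · have hpos : 0 < ‖H1.fn u‖ ^ 2 := by have := norm_pos_iff.2 h; positivity
    rw [← le_div_iff₀ hpos]
    refine csInf_le ⟨0, ?_⟩ ⟨u, hu, h, rfl⟩
    rintro r ⟨v, -, -, rfl⟩
    exact div_nonneg (Finset.sum_nonneg fun j _ => sq_nonneg _) (sq_nonneg _)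

lemma HLame.norm_sq_eq (u : HLame Ω lam mu) :
    ‖u‖ ^ 2 = ‖fnL u‖ ^ 2 + (∑ i, ∑ j, ‖H1.pd j (toH1v u i)‖ ^ 2) + ‖lameL u‖ ^ 2 := by
  have h1 : ‖u‖ ^ 2 = ‖toH1v u‖ ^ 2 + ‖lameL u‖ ^ 2 :=
    WithLp.prod_norm_sq_eq_of_L2 (u : WithLp 2 (H1v Ω × L2v Ω))
  have h2 : ∀ v : H1 Ω, ‖v‖ ^ 2 = ‖H1.fn v‖ ^ 2 + ∑ j, ‖H1.pd j v‖ ^ 2 := by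
    intro v
    have h3 := WithLp.prod_norm_sq_eq_of_L2 (v : WithLp 2 (L2 Ω × L2v Ω))
    rw [PiLp.norm_sq_eq_of_L2] at h3
    exact h3
  have h3 : ‖fnL u‖ ^ 2 = ∑ i, ‖H1.fn (toH1v u i)‖ ^ 2 := PiLp.norm_sq_eq_of_L2 _ (fnL u)
  rw [h1, h3, PiLp.norm_sq_eq_of_L2 _ (toH1v u)]
  simp only [h2, Finset.sum_add_distrib]

/-- Green's formula for u tested with u itself has no boundary term, so the elastic energy is −⟨u,
Δ*u⟩. -/
lemma HLame.korn_zeroData (hmu : 0 < mu) (hlam : 0 < 3 * lam + 2 * mu) {u : HLame Ω lam mu}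
    (hu : u ∈ zeroData Ω lam mu) :
    min mu (3 * lam + 2 * mu) * (∑ i, ∑ j, ‖H1.pd j (toH1v u i)‖ ^ 2) ≤
      -(inner ℂ (fnL u) (lameL u)).re := by
  obtain ⟨h0, h1⟩ := mem_zeroData.1 hu
  refine (korn hmu hlam _ h0).trans_eq ?_
  rw [← Complex.neg_re]
  congr 1
  rw [PiLp.inner_apply, ← Finset.sum_neg_distrib]
  refine Finset.sum_congr rfl fun i _ => ?_
  have := h1 i (toH1v u i)
  simp only [greenForm, add_apply, sum_apply, ContinuousLinearMap.comp_apply,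
    innerSLFlip_apply_apply] at this
  exact eq_neg_of_add_eq_zero_left this

lemma HLame.poincare_zeroData (hmu : 0 < mu) (hlam : 0 < 3 * lam + 2 * mu) {u : HLame Ω lam mu}
    (hu : u ∈ zeroData Ω lam mu) :
    min mu (3 * lam + 2 * mu) * dirichletEigenvalue Ω * ‖fnL u‖ ^ 2 ≤
      -(inner ℂ (fnL u) (lameL u)).re := by
  refine le_trans ?_ (korn_zeroData hmu hlam hu)
  rw [mul_assoc]
  refine mul_le_mul_of_nonneg_left ?_ (le_min hmu.le hlam.le)
  rw [PiLp.norm_sq_eq_of_L2, Finset.mul_sum]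
  exact Finset.sum_le_sum fun i _ => dirichletEigenvalue_mul_le ((mem_zeroData.1 hu).1 i)

/-- With a = ‖u‖, b = ‖Δ*u‖ and G the squared gradient norm, mG ≤ ab ≤ (a² + b²)/2 absorbs the
gradient into the graph norm. -/
lemma sq_add_add_sq_le {a b G m : ℝ} (hm : 0 < m) (h : m * G ≤ a * b) :
    2 * m / (2 * m + 1) * (a ^ 2 + G + b ^ 2) ≤ a ^ 2 + b ^ 2 := by
  have h4 := two_mul_le_add_sq a b
  rw [div_mul_eq_mul_div, div_le_iff₀ (by positivity)]
  nlinarith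

lemma neg_re_inner_le {N : Type*} [NormedAddCommGroup N] [InnerProductSpace ℂ N] (x y : N) :
    -(inner ℂ x y).re ≤ ‖x‖ * ‖y‖ :=
  (neg_le_abs _).trans ((Complex.abs_re_le_norm _).trans (norm_inner_le_norm _ _))

/-- The `ℋ(Ω)` norm of a field with vanishing Cauchy data is controlled by its graph norm. -/
lemma HLame.norm_sq_le_of_mem_zeroData (hmu : 0 < mu) (hlam : 0 < 3 * lam + 2 * mu) :
    ∃ κ > 0, ∀ u ∈ zeroData Ω lam mu, κ * ‖u‖ ^ 2 ≤ ‖fnL u‖ ^ 2 + ‖lameL u‖ ^ 2 := by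
  have hm : 0 < min mu (3 * lam + 2 * mu) := lt_min hmu hlam
  refine ⟨2 * min mu (3 * lam + 2 * mu) / (2 * min mu (3 * lam + 2 * mu) + 1), by positivity,
    fun u hu => ?_⟩
  rw [norm_sq_eq]
  exact sq_add_add_sq_le hm ((korn_zeroData hmu hlam hu).trans (neg_re_inner_le _ _))

end

/-! ### Multiplication operators, Lax–Milgram and coercivity -/

section
open Filter Topology ContDiff Convolution

variable {Ω : Opens E3} {lam mu : ℝ}

/-- Multiplication by a bounded real function on `L²(Ω)`. -/
def mulL2 (r : E3 → ℝ) (hr : MemLp r ⊤ (volume.restrict (Ω : Set E3))) : L2 Ω →L[ℂ] L2 Ω :=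
  (ContinuousLinearMap.mul ℂ ℂ).holderL (volume.restrict (Ω : Set E3)) ⊤ 2 2
    ((hr.ofReal (K := ℂ)).toLp _)

lemma coeFn_mulL2 {r : E3 → ℝ} (hr : MemLp r ⊤ (volume.restrict (Ω : Set E3))) (u : L2 Ω) :
    mulL2 r hr u =ᵐ[volume.restrict (Ω : Set E3)] fun x => (r x : ℂ) * u x := by
  have h1 := ContinuousLinearMap.coeFn_holder (r := 2) (ContinuousLinearMap.mul ℂ ℂ)
    ((hr.ofReal (K := ℂ)).toLp _) u
  have h2 := (hr.ofReal (K := ℂ)).coeFn_toLp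
  filter_upwards [h1, h2] with x hx1 hx2
  refine Eq.trans hx1 ?_
  rw [hx2]
  rfl

/-- Componentwise multiplication by a bounded real function on `(L²(Ω))³`. -/
def mulField (r : E3 → ℝ) (hr : MemLp r ⊤ (volume.restrict (Ω : Set E3))) : L2v Ω →L[ℂ] L2v Ω where
  toFun u := WithLp.toLp 2 fun i => mulL2 r hr (u i)
  map_add' u v := by ext1 i; simp
  map_smul' c u := by ext1 i; simp
  cont := (PiLp.continuous_toLp 2 _).comp (continuous_pi fun i =>
    (mulL2 r hr).continuous.comp (PiLp.proj 2 (𝕜 := ℂ) (fun _ : Fin 3 => L2 Ω) i).continuous)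

lemma mulField_apply {r : E3 → ℝ} (hr : MemLp r ⊤ (volume.restrict (Ω : Set E3))) (u : L2v Ω)
    (i : Fin 3) : mulField r hr u i = mulL2 r hr (u i) := rfl

lemma inner_mulL2 {r : E3 → ℝ} (hr : MemLp r ⊤ (volume.restrict (Ω : Set E3))) (u v : L2 Ω) :
    inner ℂ (mulL2 r hr u) v = inner ℂ u (mulL2 r hr v) := by
  rw [L2.inner_def, L2.inner_def]
  refine integral_congr_ae ?_
  filter_upwards [coeFn_mulL2 hr u, coeFn_mulL2 hr v] with x h1 h2
  rw [h1, h2]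
  simp
  ring

lemma inner_mulField {r : E3 → ℝ} (hr : MemLp r ⊤ (volume.restrict (Ω : Set E3))) (u v : L2v Ω) :
    inner ℂ (mulField r hr u) v = inner ℂ u (mulField r hr v) := by
  simp only [PiLp.inner_apply, mulField_apply, inner_mulL2]

lemma re_inner_nonneg_of_ae {q : E3 → ℝ} (hq : ∀ᵐ x ∂(volume.restrict (Ω : Set E3)), 0 ≤ q x)
    {u v : L2 Ω} (hv : v =ᵐ[volume.restrict (Ω : Set E3)] fun x => (q x : ℂ) * u x) :
    0 ≤ (inner ℂ u v).re := by
  have : inner ℂ u v = ((∫ x in (Ω : Set E3), q x * ‖u x‖ ^ 2 : ℝ) : ℂ) := by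
    rw [L2.inner_def, ← integral_complex_ofReal]
    refine integral_congr_ae ?_
    filter_upwards [hv] with x hx
    rw [hx, RCLike.inner_apply, mul_assoc, Complex.mul_conj']
    push_cast
    rfl
  rw [this, Complex.ofReal_re]
  refine integral_nonneg_of_ae ?_
  filter_upwards [hq] with x hx
  exact mul_nonneg hx (sq_nonneg _)

lemma le_re_inner_mulField {r : E3 → ℝ} (hr : MemLp r ⊤ (volume.restrict (Ω : Set E3))) {c : ℝ}
    (hc : ∀ᵐ x ∂(volume.restrict (Ω : Set E3)), c ≤ r x) (u : L2v Ω) :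
    c * ‖u‖ ^ 2 ≤ (inner ℂ u (mulField r hr u)).re := by
  rw [PiLp.norm_sq_eq_of_L2, PiLp.inner_apply, Complex.re_sum, Finset.mul_sum]
  refine Finset.sum_le_sum fun i _ => ?_
  have h := re_inner_nonneg_of_ae (q := fun x => r x - c) (u := u i)
    (v := mulL2 r hr (u i) - (c : ℂ) • u i) (by filter_upwards [hc] with x hx; linarith) (by
      filter_upwards [coeFn_mulL2 hr (u i), Lp.coeFn_sub (mulL2 r hr (u i)) ((c : ℂ) • u i),
        Lp.coeFn_smul (c : ℂ) (u i)] with x h1 h2 h3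
      rw [h2, Pi.sub_apply, h1, h3]
      simp
      ring)
  rw [inner_sub_right, inner_smul_right, inner_self_eq_norm_sq_to_K, Complex.sub_re, sub_nonneg] at h
  refine Eq.trans_le ?_ h
  simp [← Complex.ofReal_pow]

lemma mulField_neg {r : E3 → ℝ} (hr : MemLp r ⊤ (volume.restrict (Ω : Set E3))) (u : L2v Ω) :
    mulField (-r) hr.neg u = -mulField r hr u := by
  ext1 i
  refine Lp.ext ?_
  have e : (-mulField r hr u) i = -(mulL2 r hr (u i)) := rfl
  rw [e, mulField_apply]
  filter_upwards [coeFn_mulL2 hr (u i), coeFn_mulL2 hr.neg (u i),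
    Lp.coeFn_neg (mulL2 r hr (u i))] with x h1 h2 h3
  rw [h2, h3]
  simp [h1]

lemma re_inner_mulField_le {r : E3 → ℝ} (hr : MemLp r ⊤ (volume.restrict (Ω : Set E3))) {c : ℝ}
    (hc : ∀ᵐ x ∂(volume.restrict (Ω : Set E3)), r x ≤ c) (u : L2v Ω) :
    (inner ℂ u (mulField r hr u)).re ≤ c * ‖u‖ ^ 2 := by
  have h := le_re_inner_mulField hr.neg (c := -c)
    (by filter_upwards [hc] with x hx; exact neg_le_neg hx) u
  rw [mulField_neg hr, inner_neg_right, Complex.neg_re] at h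
  linarith

/-- With P multiplication by ρ and B by (ρ − 1)⁻¹, this is PB − B = 1, the only form in which the
inverse of ρ − 1 is used abstractly. -/
lemma mulField_mulField_sub {r s : E3 → ℝ} (hr : MemLp r ⊤ (volume.restrict (Ω : Set E3)))
    (hs : MemLp s ⊤ (volume.restrict (Ω : Set E3)))
    (h : ∀ᵐ x ∂(volume.restrict (Ω : Set E3)), (r x - 1) * s x = 1) (u : L2v Ω) :
    mulField r hr (mulField s hs u) - mulField s hs u = u := by
  ext1 i
  refine Lp.ext ?_
  have e : (mulField r hr (mulField s hs u) - mulField s hs u) i =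
    mulL2 r hr (mulL2 s hs (u i)) - mulL2 s hs (u i) := rfl
  rw [e]
  filter_upwards [h, coeFn_mulL2 hs (u i), coeFn_mulL2 hr (mulL2 s hs (u i)),
    Lp.coeFn_sub (mulL2 r hr (mulL2 s hs (u i))) (mulL2 s hs (u i))] with x h1 h2 h3 h4
  rw [h4, Pi.sub_apply, h3, h2]
  have : ((r x : ℂ) - 1) * s x = 1 := by exact_mod_cast h1
  linear_combination u i x * this

lemma mulField_comm {r s : E3 → ℝ} (hr : MemLp r ⊤ (volume.restrict (Ω : Set E3)))
    (hs : MemLp s ⊤ (volume.restrict (Ω : Set E3))) (u : L2v Ω) :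
    mulField r hr (mulField s hs u) = mulField s hs (mulField r hr u) := by
  ext1 i
  refine Lp.ext ?_
  simp only [mulField_apply]
  filter_upwards [coeFn_mulL2 hs (u i), coeFn_mulL2 hr (mulL2 s hs (u i)),
    coeFn_mulL2 hr (u i), coeFn_mulL2 hs (mulL2 r hr (u i))] with x h1 h2 h3 h4
  rw [h2, h1, h4, h3]
  ring

/-- Variational problems with a coercive sesquilinear form on a closed subspace. -/
lemma exists_variational_solution {K H : Type*} [NormedAddCommGroup K] [InnerProductSpace ℂ K]
    [CompleteSpace K] [NormedAddCommGroup H] [InnerProductSpace ℂ H] [CompleteSpace H]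
    (X : Submodule ℂ K) (hX : IsClosed (X : Set K)) (S R : K →L[ℂ] H) {c : ℝ} (hc : 0 < c)
    (hcoer : ∀ g ∈ X, c * ‖g‖ ^ 2 ≤ ‖inner ℂ (S g) (R g)‖) :
    ∃ W : K →L[ℂ] K, ∀ k, W k ∈ X ∧ ∀ g ∈ X, inner ℂ (S g) (R (k + W k)) = 0 := by
  have : CompleteSpace X := hX.completeSpace_coe
  -- A is the adjoint of S on X, so the problem is A R (k + W k) = 0. Coercivity makes T = A R on X
  -- invertible, and W = −T⁻¹ A R.
  set A : H →L[ℂ] X := ContinuousLinearMap.adjoint (S.comp X.subtypeL) with hA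
  set T : X →L[ℂ] X := A.comp (R.comp X.subtypeL) with hT
  have hinner : ∀ (y : H) (g : X), inner ℂ (A y) g = inner ℂ y (S g) := fun y g => by
    rw [hA, ContinuousLinearMap.adjoint_inner_left]; rfl
  have hunit : IsUnit T := by
    refine T.isUnit_of_forall_le_norm_inner_map (c := ⟨c, hc.le⟩) hc fun x => ?_
    have h1 : inner ℂ (T x) x = inner ℂ (R x) (S x) := hinner _ _
    rw [h1, norm_inner_symm, mul_comm]
    exact hcoer x x.2
  obtain ⟨T', hT'⟩ := hunit.exists_right_inv
  refine ⟨-(X.subtypeL.comp (T'.comp (A.comp R))), fun k => ⟨?_, fun g hg => ?_⟩⟩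
  · exact X.neg_mem (T' (A (R k))).2
  · have h1 : A (R (k + -(T' (A (R k)) : K))) = 0 := by
      have h2 : A (R (T' (A (R k)) : K)) = A (R k) :=
        congrArg (fun f : X →L[ℂ] X => f (A (R k))) hT'
      rw [← sub_eq_add_neg, map_sub, map_sub, h2, sub_self]
    have h3 := hinner (R (k + -(T' (A (R k)) : K))) ⟨g, hg⟩
    rw [h1, inner_zero_left] at h3
    rw [← inner_conj_symm]
    exact (congrArg conj h3.symm).trans (map_zero _)

section coercivity
variable {H : Type*} [NormedAddCommGroup H] [InnerProductSpace ℂ H] {P B : H →L[ℂ] H}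
  {a b : H} {s c Λ κ : ℝ}

/-- Here a = g and b = Δ*g. With y = b + sPa, the other factor is y − s(P − 1)a, and B undoes P − 1,
so the cross term is s⟨a, y⟩ = s⟨a, b⟩ + s²⟨a, Pa⟩. The Poincaré bound outweighs the last term. -/
lemma coercive_of_one_lt (hs : 0 < s) (hP : ∀ x y, inner ℂ (P x) y = inner ℂ x (P y))
    (hid : ∀ y, P (B y) - B y = y) (hB : ∀ y, c * ‖y‖ ^ 2 ≤ (inner ℂ y (B y)).re)
    (hab : Λ * ‖a‖ ^ 2 ≤ -(inner ℂ a b).re) (hPa : (inner ℂ a (P a)).re ≤ κ * ‖a‖ ^ 2) :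
    c * ‖b + (s : ℂ) • P a‖ ^ 2 + s * (Λ - s * κ) * ‖a‖ ^ 2 ≤
      (inner ℂ (b + (s : ℂ) • a) (B (b + (s : ℂ) • P a))).re := by
  set y := b + (s : ℂ) • P a with hy
  have e1 : b + (s : ℂ) • a = y - (s : ℂ) • (P a - a) := by rw [hy, smul_sub]; abel
  have e2 : inner ℂ (P a - a) (B y) = inner ℂ a b + s * inner ℂ a (P a) := by
    rw [inner_sub_left, hP, ← inner_sub_right, hid, hy, inner_add_right, inner_smul_right]
  have e3 : inner ℂ (b + (s : ℂ) • a) (B y) =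
      inner ℂ y (B y) - s * (inner ℂ a b + s * inner ℂ a (P a)) := by
    rw [e1, inner_sub_left, inner_smul_left, e2, Complex.conj_ofReal]
  rw [e3]
  simp only [Complex.sub_re, Complex.re_ofReal_mul, Complex.add_re]
  have := hB y
  have h1 := mul_le_mul_of_nonneg_left hab hs.le
  have h2 := mul_le_mul_of_nonneg_left hPa (mul_pos hs hs).le
  nlinarith

/-- Here B is negative and the square is completed around y = b + sa: B(b + sPa) = By + sa, and
Re⟨y, a⟩ = Re⟨a, b⟩ + s‖a‖². -/
lemma coercive_of_lt_one (hs : 0 < s)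
    (hid : ∀ y, B (P y) - B y = y) (hB : ∀ y, c * ‖y‖ ^ 2 ≤ -(inner ℂ y (B y)).re)
    (hab : Λ * ‖a‖ ^ 2 ≤ -(inner ℂ a b).re) :
    c * ‖b + (s : ℂ) • a‖ ^ 2 + s * (Λ - s) * ‖a‖ ^ 2 ≤
      -(inner ℂ (b + (s : ℂ) • a) (B (b + (s : ℂ) • P a))).re := by
  set y := b + (s : ℂ) • a with hy
  have e1 : b + (s : ℂ) • P a = y + (s : ℂ) • (P a - a) := by rw [hy, smul_sub]; abel
  have e2 : B (b + (s : ℂ) • P a) = B y + (s : ℂ) • a := by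
    rw [e1, map_add, map_smul, map_sub, hid]
  have e3 : (inner ℂ y a).re = (inner ℂ a b).re + s * ‖a‖ ^ 2 := by
    rw [hy, inner_add_left, inner_smul_left, Complex.conj_ofReal, Complex.add_re,
      Complex.re_ofReal_mul, inner_self_eq_norm_sq_to_K, ← inner_conj_symm, Complex.conj_re]
    simp [← Complex.ofReal_pow]
  rw [e2, inner_add_right, inner_smul_right, Complex.add_re, Complex.re_ofReal_mul, e3]
  have := hB y
  have h1 := mul_le_mul_of_nonneg_left hab hs.le
  nlinarith

/-- Coercivity controls ‖b + s f a‖ (here x) and ‖a‖ (here y); this recovers ‖b‖ (here z), hence the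
graph norm, through the triangle inequality. -/
lemma exists_mul_sq_add_sq_le {c₁ c₂ t : ℝ} (h₁ : 0 < c₁) (h₂ : 0 < c₂) :
    ∃ δ > 0, ∀ x y z : ℝ, 0 ≤ y → 0 ≤ z → z ≤ x + t * y →
      δ * (y ^ 2 + z ^ 2) ≤ c₁ * x ^ 2 + c₂ * y ^ 2 := by
  refine ⟨min (c₁ / 2) (c₂ / (1 + 2 * t ^ 2)), by positivity, fun x y z hy hz h => ?_⟩
  set δ := min (c₁ / 2) (c₂ / (1 + 2 * t ^ 2))
  have hδ : 0 < δ := by positivity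
  have d1 : δ ≤ c₁ / 2 := min_le_left _ _
  have d2 : δ * (1 + 2 * t ^ 2) ≤ c₂ := by
    rw [← le_div_iff₀ (by positivity)]; exact min_le_right _ _
  have h3 : z ^ 2 ≤ 2 * x ^ 2 + 2 * t ^ 2 * y ^ 2 := by
    have h4 : z ^ 2 ≤ (x + t * y) ^ 2 := pow_le_pow_left₀ hz h 2
    nlinarith [sq_nonneg (x - t * y)]
  have h5 := mul_le_mul_of_nonneg_left h3 hδ.le
  have h6 := mul_le_mul_of_nonneg_right d1 (sq_nonneg x)
  have h7 := mul_le_mul_of_nonneg_right d2 (sq_nonneg y)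
  nlinarith

lemma norm_le_norm_add_smul (f : H →L[ℂ] H) (hs : 0 < s) (a b : H) :
    ‖b‖ ≤ ‖b + (s : ℂ) • f a‖ + s * ‖f‖ * ‖a‖ := by
  calc ‖b‖ = ‖(b + (s : ℂ) • f a) - (s : ℂ) • f a‖ := by simp
    _ ≤ ‖b + (s : ℂ) • f a‖ + ‖(s : ℂ) • f a‖ := norm_sub_le _ _
    _ ≤ _ := by
      rw [norm_smul, Complex.norm_real, Real.norm_of_nonneg hs.le, mul_assoc]
      gcongr
      exact f.le_opNorm a

end coercivity

end

/-! ### Equivalence with the variational problem -/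

section
open Filter Topology

variable {Ω : Opens E3} {lam mu : ℝ}

lemma testField_eq_zero_of_inner {x : L2v Ω}
    (h : ∀ Φ : Fin 3 → 𝓓(Ω, ℂ), inner ℂ (testField Φ) x = 0) : x = 0 := by
  ext1 i
  have h1 : ∀ φ : 𝓓(Ω, ℂ), ∫ y in (Ω : Set E3), x i y * φ y = 0 := by
    intro φ
    have h2 := h (Pi.single i (conjTest φ))
    rw [inner_testField, Finset.sum_eq_single i ?_ (by simp)] at h2
    · rw [Pi.single_eq_same, conjTest_conjTest] at h2
      exact h2
    · intro k _ hk
      have : conjTest (0 : 𝓓(Ω, ℂ)) = 0 := by ext; simp [conjTest_apply]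
      simp [hk, this]
  have h3 := Ω.isOpen.ae_eq_zero_of_integral_contDiff_smul_eq_zero (μ := volume)
    ((isL2Off_zeroExt (x i)).locallyIntegrable.locallyIntegrableOn (Ω : Set E3)) ?_
  · refine Lp.ext (EventuallyEq.trans ?_ (Lp.coeFn_zero _ _ _).symm)
    filter_upwards [zeroExt_ae_eq (x i), (ae_restrict_iff' Ω.isOpen.measurableSet).2 h3]
      with y hy1 hy2
    rw [← hy1, hy2]
    rfl
  · intro g hg hgs hgt
    let φ : 𝓓(Ω, ℂ) := ⟨fun y => (g y : ℂ), Complex.ofRealCLM.contDiff.comp hg,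
      hgs.comp_left (g := ((↑) : ℝ → ℂ)) Complex.ofReal_zero,
      (tsupport_comp_subset (g := ((↑) : ℝ → ℂ)) Complex.ofReal_zero g).trans hgt⟩
    rw [← h1 φ, ← setIntegral_eq_integral_of_forall_compl_eq_zero (s := (Ω : Set E3))
      (fun y hy => by rw [(isL2Off_zeroExt (x i)).zero y hy, smul_zero])]
    refine integral_congr_ae ?_
    filter_upwards [zeroExt_ae_eq (x i)] with y hy
    rw [hy, mul_comm, Complex.real_smul]
    rfl

namespace HLame

/-- The weak Lamé equation may be tested with fields with vanishing Cauchy data. -/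
lemma inner_lameL_eq_of_isWeakLame (hbdd : Bornology.IsBounded (Ω : Set E3))
    (hΩ : HasC2Boundary Ω) {q p : L2v Ω}
    (h : ∀ Φ : Fin 3 → 𝓓(Ω, ℂ), inner ℂ (testField (lameTest lam mu Φ)) q = inner ℂ (testField Φ) p)
    {g : HLame Ω lam mu} (hg : g ∈ zeroData Ω lam mu) :
    inner ℂ (lameL g) q = inner ℂ (fnL g) p := by
  obtain ⟨h0, h1⟩ := mem_zeroData.1 hg
  have hcl : IsClosed {x : L2v Ω × L2v Ω | inner ℂ x.2 q = inner ℂ x.1 p} :=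
    isClosed_eq (continuous_snd.inner continuous_const) (continuous_fst.inner continuous_const)
  have hsub : (Set.range fun Φ : Fin 3 → 𝓓(Ω, ℂ) =>
      (testField Φ, testField (lameTest lam mu Φ))) ⊆
      {x : L2v Ω × L2v Ω | inner ℂ x.2 q = inner ℂ x.1 p} := by
    rintro _ ⟨Φ, rfl⟩
    exact h Φ
  have hmem := closure_minimal hsub hcl (mem_closure_testGraph hbdd hΩ g h0 h1)
  rw [Set.mem_ofPred_eq] at hmem
  exact hmem

lemma inner_testField_lameL (u : HLame Ω lam mu) (Φ : Fin 3 → 𝓓(Ω, ℂ)) :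
    inner ℂ (testField (lameTest lam mu Φ)) (fnL u) = inner ℂ (testField Φ) (lameL u) :=
  (isWeakLame_iff (u := fnL u) (g := lameL u) (fun _ => ae_eq_rfl)).1 u.2 Φ

end HLame

lemma neg_mul_ae_eq_smul (c : ℝ) (v : L2v Ω) (i : Fin 3) :
    (fun x => -(c : ℂ) * v i x) =ᵐ[volume.restrict (Ω : Set E3)] (-((c : ℂ) • v) : L2v Ω) i := by
  have e : (-((c : ℂ) • v) : L2v Ω) i = -((c : ℂ) • v i) := rfl
  rw [e]
  filter_upwards [Lp.coeFn_neg ((c : ℂ) • v i), Lp.coeFn_smul (c : ℂ) (v i)] with x h1 h2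
  rw [h1, Pi.neg_apply, h2]
  simp

lemma neg_mul_mul_ae_eq_smul {ρ : E3 → ℝ} (hρ : MemLp ρ ⊤ (volume.restrict (Ω : Set E3)))
    (c : ℝ) (v : L2v Ω) (i : Fin 3) :
    (fun x => -((c * ρ x : ℝ) : ℂ) * v i x) =ᵐ[volume.restrict (Ω : Set E3)]
      (-((c : ℂ) • mulField ρ hρ v) : L2v Ω) i := by
  refine EventuallyEq.trans ?_ (neg_mul_ae_eq_smul c (mulField ρ hρ v) i)
  filter_upwards [coeFn_mulL2 hρ (v i)] with x hx
  rw [mulField_apply, hx]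
  push_cast
  ring

/-- The interior transmission problem in terms of inner products with test fields. -/
lemma isITPSolution_iff {ω : ℝ} {ρ : E3 → ℝ} (hρ : MemLp ρ ⊤ (volume.restrict (Ω : Set E3)))
    (u₀ : HLame Ω lam mu) (U V : L2v Ω) :
    IsITPSolution Ω lam mu ω ρ (trace0 (HLame.toH1v u₀)) (trace1 u₀) U V ↔
      (∀ Φ : Fin 3 → 𝓓(Ω, ℂ), inner ℂ (testField (lameTest lam mu Φ)) U =
        inner ℂ (testField Φ) (-(((ω ^ 2 : ℝ) : ℂ) • mulField ρ hρ U))) ∧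
      (∀ Φ : Fin 3 → 𝓓(Ω, ℂ), inner ℂ (testField (lameTest lam mu Φ)) V =
        inner ℂ (testField Φ) (-(((ω ^ 2 : ℝ) : ℂ) • V))) ∧
      ∃ w ∈ HLame.zeroData Ω lam mu, HLame.fnL (u₀ + w) = U - V := by
  have hU := isWeakLame_iff (lam := lam) (mu := mu) (u := U) (neg_mul_mul_ae_eq_smul hρ (ω ^ 2) U)
  have hV := isWeakLame_iff (lam := lam) (mu := mu) (u := V) (neg_mul_ae_eq_smul (ω ^ 2) V)
  rw [← hU, ← hV]
  constructor
  · rintro ⟨h1, h2, u, h3, h4, h5⟩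
    refine ⟨h1, h2, u - u₀, (HLame.sub_mem_zeroData_iff u u₀).2 ⟨h4, h5⟩, ?_⟩
    rw [add_sub_cancel]
    exact h3
  · rintro ⟨h1, h2, w, hw, h3⟩
    have h4 := (HLame.sub_mem_zeroData_iff (u₀ + w) u₀).1 (by simpa using hw)
    exact ⟨h1, h2, u₀ + w, h3, h4.1, h4.2⟩

/-- Unique solvability from coercivity of `⟪L g + s A g, B (L g + s P (A g))⟫` on a closed subspace
`X`, in terms of a family `t` of test vectors in `X`. -/
theorem exists_solution_operators {K H ι : Type*} [NormedAddCommGroup K] [InnerProductSpace ℂ K]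
    [CompleteSpace K] [NormedAddCommGroup H] [InnerProductSpace ℂ H] [CompleteSpace H]
    (X : Submodule ℂ K) (hX : IsClosed (X : Set K)) (A L : K →L[ℂ] H) (t : ι → K)
    (htX : ∀ i, t i ∈ X) {a b : ι → H} (ha : ∀ i, A (t i) = a i) (hb : ∀ i, L (t i) = b i)
    (hsymm : ∀ u i, inner ℂ (b i) (A u) = inner ℂ (a i) (L u))
    (hdense : ∀ x, (∀ i, inner ℂ (a i) x = 0) → x = 0)
    (hext : ∀ q p, (∀ i, inner ℂ (b i) q = inner ℂ (a i) p) →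
      ∀ g ∈ X, inner ℂ (L g) q = inner ℂ (A g) p)
    {s c : ℝ} (hs : 0 < s) (hc : 0 < c) (P B : H →L[ℂ] H)
    (hPB : ∀ y, P (B y) - B y = y) (hBP : ∀ y, B (P y) - B y = y)
    (hcoer : ∀ g ∈ X, c * ‖g‖ ^ 2 ≤
      ‖inner ℂ (L g + (s : ℂ) • A g) (B (L g + (s : ℂ) • P (A g)))‖) :
    ∃ (𝒰 𝒱 : K → H) (C : ℝ), 0 < C ∧ (∀ u₀, ‖𝒰 u₀‖ + ‖𝒱 u₀‖ ≤ C * ‖u₀‖) ∧ ∀ (u₀ : K) (U V : H),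
      ((∀ i, inner ℂ (b i) U = inner ℂ (a i) (-((s : ℂ) • P U))) ∧
      (∀ i, inner ℂ (b i) V = inner ℂ (a i) (-((s : ℂ) • V))) ∧
      ∃ w ∈ X, A (u₀ + w) = U - V) ↔ U = 𝒰 u₀ ∧ V = 𝒱 u₀ := by
  obtain rfl : (fun i => A (t i)) = a := funext ha
  obtain rfl : (fun i => L (t i)) = b := funext hb
  set S : K →L[ℂ] H := L + (s : ℂ) • A with hS
  set R : K →L[ℂ] H := B.comp (L + (s : ℂ) • P.comp A) with hR
  have hsc : (s : ℂ) ≠ 0 := by exact_mod_cast hs.ne'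
  have hSa : ∀ g, S g = L g + (s : ℂ) • A g := fun g => rfl
  have hRa : ∀ g, R g = B (L g + (s : ℂ) • P (A g)) := fun g => rfl
  obtain ⟨W, hW⟩ := exists_variational_solution X hX
    S R hc hcoer
  have hWuniq : ∀ u₀, ∀ w ∈ X,
      (∀ g ∈ X, inner ℂ (S g) (R (u₀ + w)) = 0) → w = W u₀ := by
    intro u₀ w hw h
    have hd := X.sub_mem hw (hW u₀).1
    have h1 : inner ℂ (S (w - W u₀)) (R (w - W u₀)) = 0 := by
      have e : R (w - W u₀) = R (u₀ + w) - R (u₀ + W u₀) := by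
        rw [← map_sub]; congr 1; abel
      rw [e, inner_sub_right, h _ hd, (hW u₀).2 _ hd, sub_zero]
    have h2 := hcoer _ hd
    rw [← hSa, ← hRa, h1, norm_zero] at h2
    have h3 : ‖w - W u₀‖ ^ 2 ≤ 0 := by
      by_contra! h4
      exact absurd h2 (not_le.2 (mul_pos hc h4))
    have h4 : ‖w - W u₀‖ = 0 := pow_eq_zero_iff (two_ne_zero) |>.1 (le_antisymm h3 (sq_nonneg _))
    exact sub_eq_zero.1 (norm_eq_zero.1 h4)
  set Y : K →L[ℂ] K := ContinuousLinearMap.id ℂ _ + W with hY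
  have hYa : ∀ u, Y u = u + W u := fun u => rfl
  set 𝒱 : K →L[ℂ] H := (-(s : ℂ)⁻¹) • R.comp Y with h𝒱
  have h𝒱a : ∀ u, 𝒱 u = (-(s : ℂ)⁻¹) • R (Y u) := fun u => rfl
  refine ⟨⇑(𝒱 + A.comp Y), 𝒱, ‖𝒱 + A.comp Y‖ + ‖𝒱‖ + 1, by positivity, fun u₀ => ?_,
    fun u₀ U V => ?_⟩
  · linarith [(𝒱 + A.comp Y).le_opNorm u₀, 𝒱.le_opNorm u₀, norm_nonneg u₀]
  have h𝒰a : (𝒱 + A.comp Y) u₀ = 𝒱 u₀ + A (Y u₀) := rfl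
  constructor
  · rintro ⟨h1, h2, w, hw, h3⟩
    -- The difference of the two weak equations identifies L(u₀ + w), because test fields separate
    -- points.
    have hL : L (u₀ + w) = -((s : ℂ) • P U) + (s : ℂ) • V := by
      rw [← sub_eq_zero]
      refine hdense _ fun i => ?_
      rw [inner_sub_right, ← hsymm, h3, inner_sub_right, h1, h2,
        inner_add_right, inner_neg_right (A (t i)) ((s : ℂ) • V)]
      ring
    have hUV : U = V + A (u₀ + w) := by rw [h3]; abel
    -- L(u₀ + w) + sPA(u₀ + w) = −s(P − 1)V, and B undoes P − 1; V is thus recovered from w.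
    have hRV : R (u₀ + w) = -((s : ℂ) • V) := by
      have e : L (u₀ + w) + (s : ℂ) • P (A (u₀ + w)) = -((s : ℂ) • (P V - V)) := by
        rw [hL, hUV, map_add, smul_add, smul_sub]; abel
      rw [hRa, e, map_neg, map_smul, map_sub, hBP]
    have hVR : V = (-(s : ℂ)⁻¹) • R (u₀ + w) := by
      rw [hRV, smul_neg, neg_smul, neg_neg, inv_smul_smul₀ hsc]
    have hwW : w = W u₀ := by
      -- By density the equation for V may be tested with every g in X, which is the variational
      -- equation for w.
      refine hWuniq u₀ w hw fun g hg => ?_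
      have h4 := hext _ _ h2 g hg
      rw [hRV, inner_neg_right, hSa, inner_add_left, inner_smul_right, inner_smul_right,
        h4, inner_smul_left, inner_neg_right, inner_smul_right, Complex.conj_ofReal]
      ring
    have hV : V = 𝒱 u₀ := by rw [hVR, hwW, h𝒱a, hYa]
    exact ⟨by rw [h𝒰a, ← hV, hYa, ← hwW]; exact hUV, hV⟩
  · rintro ⟨rfl, rfl⟩
    have hR' : R (Y u₀) = -((s : ℂ) • 𝒱 u₀) := by
      rw [h𝒱a, neg_smul, smul_neg, neg_neg, smul_inv_smul₀ hsc]
    have h2 : ∀ i, inner ℂ (L (t i)) (𝒱 u₀) =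
        inner ℂ (A (t i)) (-((s : ℂ) • 𝒱 u₀)) := by
      intro i
      have h3 := (hW u₀).2 _ (htX i)
      rw [← hYa, hSa, inner_add_left, inner_smul_left,
        Complex.conj_ofReal, h𝒱a] at *
      rw [inner_neg_right, inner_smul_right, inner_smul_right, inner_smul_right]
      linear_combination (-(s : ℂ)⁻¹) * h3
    refine ⟨fun i => ?_, h2, W u₀, (hW u₀).1, ?_⟩
    · have h4 : L (Y u₀) + (s : ℂ) • P (A (Y u₀)) =
          P (R (Y u₀)) - R (Y u₀) := by rw [hRa, hPB]
      rw [hR', map_neg, map_smul] at h4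
      have h5 : -((s : ℂ) • P ((𝒱 + A.comp Y) u₀)) =
          -((s : ℂ) • 𝒱 u₀) + L (Y u₀) := by
        rw [h𝒰a, map_add, smul_add, eq_sub_of_add_eq h4]; abel
      rw [h5, h𝒰a, inner_add_right, h2, hsymm, inner_add_right]
    · rw [h𝒰a, hYa]; abel

end

/-! ### Coercivity under the contrast and frequency assumptions -/

section
open Filter Topology

variable {Ω : Opens E3} {lam mu : ℝ}

/-- Real-valued essential bounds are meaningful only for essentially bounded functions; membership
in L^∞ supplies this. -/
lemma ae_essInf_le_and_le_essSup {ρ : E3 → ℝ}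
    (hρ : MemLp ρ ⊤ (volume.restrict (Ω : Set E3))) :
    ∀ᵐ x ∂(volume.restrict (Ω : Set E3)), essInf ρ (volume.restrict (Ω : Set E3)) ≤ ρ x ∧
      ρ x ≤ essSup ρ (volume.restrict (Ω : Set E3)) := by
  obtain ⟨C, hC⟩ : ∃ C : ℝ, ∀ᵐ x ∂(volume.restrict (Ω : Set E3)), ‖ρ x‖ ≤ C := by
    have h1 := hρ.2
    rw [eLpNorm_exponent_top] at h1
    refine ⟨(eLpNormEssSup ρ (volume.restrict (Ω : Set E3))).toReal, ?_⟩
    filter_upwards [enorm_ae_le_eLpNormEssSup ρ (volume.restrict (Ω : Set E3))] with x hx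
    rw [← toReal_enorm]
    exact ENNReal.toReal_mono h1.ne hx
  have hle : IsBoundedUnder (· ≤ ·) (ae (volume.restrict (Ω : Set E3))) ρ :=
    ⟨C, by rw [eventually_map]; filter_upwards [hC] with x hx; exact (abs_le.1 hx).2⟩
  have hge : IsBoundedUnder (· ≥ ·) (ae (volume.restrict (Ω : Set E3))) ρ :=
    ⟨-C, by rw [eventually_map]; filter_upwards [hC] with x hx; exact (abs_le.1 hx).1⟩
  filter_upwards [ae_essInf_le hge, ae_le_essSup hle] with x h1 h2
  exact ⟨h1, h2⟩

lemma memLp_inv_sub_one {ρ : E3 → ℝ} (hρ : MemLp ρ ⊤ (volume.restrict (Ω : Set E3))) {d : ℝ}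
    (hd : 0 < d) (h : ∀ᵐ x ∂(volume.restrict (Ω : Set E3)), d ≤ |ρ x - 1|) :
    MemLp (fun x => (ρ x - 1)⁻¹) ⊤ (volume.restrict (Ω : Set E3)) := by
  refine memLp_top_of_bound (C := d⁻¹)
    ((hρ.1.aemeasurable.sub_const 1).inv.aestronglyMeasurable) ?_
  filter_upwards [h] with x hx
  rw [norm_inv, Real.norm_eq_abs]
  exact inv_anti₀ hd hx

/-- The part common to both signs of ρ − 1: only a lower bound on |ρ − 1| and coercivity on X enter.
-/
lemma exists_isITPSolution_iff_of_coercive (hbdd : Bornology.IsBounded (Ω : Set E3))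
    (hΩ : HasC2Boundary Ω) {ρ : E3 → ℝ} (hρ : MemLp ρ ⊤ (volume.restrict (Ω : Set E3)))
    {ω : ℝ} (hω : ω ≠ 0) {d c : ℝ} (hd : 0 < d)
    (h : ∀ᵐ x ∂(volume.restrict (Ω : Set E3)), d ≤ |ρ x - 1|) (hc : 0 < c)
    (hcoer : ∀ g ∈ HLame.zeroData Ω lam mu, c * ‖g‖ ^ 2 ≤
      ‖inner ℂ (HLame.lameL g + ((ω ^ 2 : ℝ) : ℂ) • HLame.fnL g)
        (mulField _ (memLp_inv_sub_one hρ hd h)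
          (HLame.lameL g + ((ω ^ 2 : ℝ) : ℂ) • mulField ρ hρ (HLame.fnL g)))‖) :
    ∃ (𝒰 𝒱 : HLame Ω lam mu → L2v Ω) (C : ℝ), 0 < C ∧
      (∀ u₀, ‖𝒰 u₀‖ + ‖𝒱 u₀‖ ≤ C * ‖u₀‖) ∧ ∀ (u₀ : HLame Ω lam mu) (U V : L2v Ω),
      IsITPSolution Ω lam mu ω ρ (trace0 (HLame.toH1v u₀)) (trace1 u₀) U V ↔
        U = 𝒰 u₀ ∧ V = 𝒱 u₀ := by
  have hid := mulField_mulField_sub hρ (memLp_inv_sub_one hρ hd h) (by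
    filter_upwards [h] with x hx
    exact mul_inv_cancel₀ (abs_pos.1 (hd.trans_le hx)))
  obtain ⟨𝒰, 𝒱, C, hC, hle, hsol⟩ :=
    @exists_solution_operators (HLame Ω lam mu) (L2v Ω) (Fin 3 → 𝓓(Ω, ℂ))
    (HLame Ω lam mu).normedAddCommGroup instInnerHLame inferInstance
    (PiLp.normedAddCommGroup 2 _) (PiLp.innerProductSpace _) inferInstance
    (HLame.zeroData Ω lam mu) HLame.isClosed_zeroData HLame.fnL HLame.lameL (testHLame lam mu) testHLame_mem_zeroData
    _ _ fnL_testHLame lameL_testHLame HLame.inner_testField_lameL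
    (fun x => testField_eq_zero_of_inner)
    (fun q p hqp g hg => HLame.inner_lameL_eq_of_isWeakLame hbdd hΩ hqp hg)
    (ω ^ 2) c (sq_pos_of_ne_zero hω) hc (mulField ρ hρ) (mulField _ (memLp_inv_sub_one hρ hd h)) hid
    (fun y => by rw [← mulField_comm, hid]) hcoer
  exact ⟨𝒰, 𝒱, C, hC, hle, fun u₀ U V => (isITPSolution_iff hρ u₀ U V).trans (hsol u₀ U V)⟩

/-- The solutions of the interior transmission problem are given by bounded linear operators. -/
theorem exists_isITPSolution_iff (hne : (Ω : Set E3).Nonempty)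
    (hbdd : Bornology.IsBounded (Ω : Set E3)) (hΩ : HasC2Boundary Ω)
    (hmu : 0 < mu) (hlam : 0 < 3 * lam + 2 * mu)
    {ρ : E3 → ℝ} (hρ : MemLp ρ ⊤ (volume.restrict (Ω : Set E3))) (hpos : ∀ x ∈ Ω, 0 < ρ x)
    (hcontrast : 1 < essInf ρ (volume.restrict (Ω : Set E3)) ∨
      essSup ρ (volume.restrict (Ω : Set E3)) < 1)
    {ω : ℝ} (hω : ω ≠ 0)
    (hsmall : ω ^ 2 < min (min mu (3 * lam + 2 * mu) * dirichletEigenvalue Ω /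
      essSup ρ (volume.restrict (Ω : Set E3))) (min mu (3 * lam + 2 * mu) * dirichletEigenvalue Ω)) :
    ∃ (𝒰 𝒱 : HLame Ω lam mu → L2v Ω) (C : ℝ), 0 < C ∧
      (∀ u₀, ‖𝒰 u₀‖ + ‖𝒱 u₀‖ ≤ C * ‖u₀‖) ∧ ∀ (u₀ : HLame Ω lam mu) (U V : L2v Ω),
      IsITPSolution Ω lam mu ω ρ (trace0 (HLame.toH1v u₀)) (trace1 u₀) U V ↔
        U = 𝒰 u₀ ∧ V = 𝒱 u₀ := by
  have hs : 0 < ω ^ 2 := by positivity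
  have hess := ae_essInf_le_and_le_essSup hρ
  set ρlow := essInf ρ (volume.restrict (Ω : Set E3))
  set ρup := essSup ρ (volume.restrict (Ω : Set E3))
  obtain ⟨hsm1, hsm2⟩ := lt_min_iff.1 hsmall
  obtain ⟨κ, hκ, hnorm⟩ := HLame.norm_sq_le_of_mem_zeroData (Ω := Ω) hmu hlam
  have hfinish : ∀ {δ r : ℝ} {g : HLame Ω lam mu}, 0 < δ → g ∈ HLame.zeroData Ω lam mu →
      δ * (‖HLame.fnL g‖ ^ 2 + ‖HLame.lameL g‖ ^ 2) ≤ r → δ * κ * ‖g‖ ^ 2 ≤ r := by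
    intro δ r g hδ hg h
    rw [mul_assoc]
    exact (mul_le_mul_of_nonneg_left (hnorm g hg) hδ.le).trans h
  rcases hcontrast with hgt | hlt
  · have hlow : ∀ᵐ x ∂(volume.restrict (Ω : Set E3)), ρlow - 1 ≤ |ρ x - 1| := by
      filter_upwards [hess] with x hx
      exact (by linarith [hx.1] : ρlow - 1 ≤ ρ x - 1).trans (le_abs_self _)
    -- As Ω is nonempty and open it has positive measure, so the a.e. bounds hold at some point and
    -- give ρlow ≤ ρup. Then (ρup − 1)⁻¹ is a positive lower bound for (ρ − 1)⁻¹, and ρup can be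
    -- cleared from the frequency bound.
    have hup : 1 < ρup := by
      have : (ae (volume.restrict (Ω : Set E3))).NeBot := by
        rw [ae_neBot, Ne, Measure.restrict_eq_zero]
        exact (Ω.isOpen.measure_pos volume hne).ne'
      obtain ⟨x, hx⟩ := hess.exists
      linarith [hx.1, hx.2]
    have hc : 0 < (ρup - 1)⁻¹ := inv_pos.2 (by linarith)
    have hc2 : 0 < ω ^ 2 * (min mu (3 * lam + 2 * mu) * dirichletEigenvalue Ω - ω ^ 2 * ρup) := by
      rw [lt_div_iff₀ (by linarith)] at hsm1
      exact mul_pos hs (by linarith)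
    have hd : 0 < ρlow - 1 := by linarith
    obtain ⟨δ, hδ, hδ'⟩ := exists_mul_sq_add_sq_le (t := ω ^ 2 * ‖mulField ρ hρ‖) hc hc2
    refine exists_isITPSolution_iff_of_coercive hbdd hΩ hρ hω hd hlow
      (mul_pos hδ hκ) fun g hg => hfinish hδ hg ?_
    refine (hδ' _ _ _ (norm_nonneg _) (norm_nonneg _)
      (norm_le_norm_add_smul (mulField ρ hρ) hs (HLame.fnL g) (HLame.lameL g))).trans ?_
    refine le_trans ?_ ((le_abs_self _).trans (Complex.abs_re_le_norm _))
    refine coercive_of_one_lt hs (inner_mulField hρ) ?_ ?_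
      (HLame.poincare_zeroData hmu hlam hg) (re_inner_mulField_le hρ (hess.mono fun x hx => hx.2) _)
    · refine mulField_mulField_sub hρ _ ?_
      filter_upwards [hlow] with x hx
      exact mul_inv_cancel₀ (abs_pos.1 (hd.trans_le hx))
    · refine le_re_inner_mulField _ ?_
      filter_upwards [hess] with x hx
      exact inv_anti₀ (by linarith [hx.1]) (by linarith [hx.2])
  · have hlow : ∀ᵐ x ∂(volume.restrict (Ω : Set E3)), 1 - ρup ≤ |ρ x - 1| := by
      filter_upwards [hess] with x hx
      exact (by linarith [hx.2] : 1 - ρup ≤ -(ρ x - 1)).trans (neg_le_abs _)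
    have hd : 0 < 1 - ρup := by linarith
    have hc2 : 0 < ω ^ 2 * (min mu (3 * lam + 2 * mu) * dirichletEigenvalue Ω - ω ^ 2) :=
      mul_pos hs (by linarith)
    -- The square is now completed around Δ*g + sg, so the identity replaces multiplication by ρ.
    obtain ⟨δ, hδ, hδ'⟩ := exists_mul_sq_add_sq_le
      (t := ω ^ 2 * ‖ContinuousLinearMap.id ℂ (L2v Ω)‖) one_pos hc2
    refine exists_isITPSolution_iff_of_coercive hbdd hΩ hρ hω hd hlow
      (mul_pos hδ hκ) fun g hg => hfinish hδ hg ?_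
    refine (hδ' _ _ _ (norm_nonneg _) (norm_nonneg _)
      (norm_le_norm_add_smul (ContinuousLinearMap.id ℂ (L2v Ω)) hs (HLame.fnL g)
        (HLame.lameL g))).trans ?_
    refine le_trans ?_ ((neg_le_abs _).trans (Complex.abs_re_le_norm _))
    refine coercive_of_lt_one hs ?_ ?_ (HLame.poincare_zeroData hmu hlam hg)
    · intro y
      rw [← mulField_comm]
      refine mulField_mulField_sub hρ _ ?_ y
      filter_upwards [hlow] with x hx
      exact mul_inv_cancel₀ (abs_pos.1 (hd.trans_le hx))
    · intro y
      -- Positivity of ρ gives 0 < 1 − ρ < 1, hence (ρ − 1)⁻¹ ≤ −1; this is the coercivity constant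
      -- 1 used above.
      have h1 := re_inner_mulField_le (memLp_inv_sub_one hρ hd hlow) (c := -1) (by
        filter_upwards [hess, ae_restrict_mem Ω.isOpen.measurableSet] with x hx hxΩ
        have hx0 := hpos x hxΩ
        rw [← neg_sub, inv_neg, neg_le_neg_iff]
        exact (one_le_inv₀ (by linarith [hx.2])).2 (by linarith)) y
      linarith

end

end Elastic

end

theorem mainTheorem7
    (Ω : TopologicalSpace.Opens Elastic.E3)
    (hΩ_conn : IsConnected (Ω : Set Elastic.E3))
    (hΩ_bdd : Bornology.IsBounded (Ω : Set Elastic.E3))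
    (hΩ_C2 : Elastic.HasC2Boundary Ω)
    (lam mu : ℝ) (hmu : 0 < mu) (hlam : 0 < 3 * lam + 2 * mu)
    (ρ : Elastic.E3 → ℝ)
    (hρ_bdd : MeasureTheory.MemLp ρ ⊤ (MeasureTheory.volume.restrict (Ω : Set Elastic.E3)))
    (hρ_pos : ∀ x ∈ Ω, 0 < ρ x)
    (ρlow ρup : ℝ)
    (hρlow : ρlow = essInf ρ (MeasureTheory.volume.restrict (Ω : Set Elastic.E3)))
    (hρup : ρup = essSup ρ (MeasureTheory.volume.restrict (Ω : Set Elastic.E3)))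
    (hcontrast : 1 < ρlow ∨ ρup < 1)
    (ω : ℝ) (hω : ω ≠ 0)
    (m : ℝ) (hm : m = min mu (3 * lam + 2 * mu))
    (hsmall : ω ^ 2 < min (m * Elastic.dirichletEigenvalue Ω / ρup)
      (m * Elastic.dirichletEigenvalue Ω)) :
    ∃ C : ℝ, 0 < C ∧
      ∀ (f : Fin 3 → Elastic.HHalf Ω) (h : Fin 3 → Elastic.HMinusHalf Ω)
        (u₀ : Elastic.HLame Ω lam mu),
        Elastic.trace0 (Elastic.HLame.toH1v u₀) = f → Elastic.trace1 u₀ = h →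
        (∃! p : Elastic.L2v Ω × Elastic.L2v Ω,
          Elastic.IsITPSolution Ω lam mu ω ρ f h p.1 p.2) ∧
        ∀ U V : Elastic.L2v Ω, Elastic.IsITPSolution Ω lam mu ω ρ f h U V →
          ‖U‖ + ‖V‖ ≤ C * ‖u₀‖ := by
  subst hρlow hρup hm
  obtain ⟨𝒰, 𝒱, C, hC, hle, hsol⟩ := Elastic.exists_isITPSolution_iff hΩ_conn.nonempty hΩ_bdd hΩ_C2
    hmu hlam hρ_bdd hρ_pos hcontrast hω hsmall
  refine ⟨C, hC, ?_⟩
  rintro f h u₀ rfl rfl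
  refine ⟨⟨(𝒰 u₀, 𝒱 u₀), (hsol u₀ _ _).2 ⟨rfl, rfl⟩, ?_⟩, fun U V hUV => ?_⟩
  · rintro ⟨U, V⟩ hUV
    obtain ⟨rfl, rfl⟩ := (hsol u₀ _ _).1 hUV
    rfl
  · obtain ⟨rfl, rfl⟩ := (hsol u₀ _ _).1 hUV
    exact hle u₀
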